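/- **Setting.** Let $G=\mathbb Z$ (discrete case) or $G=\mathbb R$ (continuous case). For $a\in\mathbb R$ let $\lfloor a\rceil!=\Gamma(a+1)$ if $a$ is not a negative integer and $\lfloor a\rceil!=(-1)^{a+1}/(-a-1)!$ otherwise. Let $\ell_0=\log x,\ \ell_1=\log\log x,\dots$; an *order* is a finitely supported integer sequence $\alpha$, and $\ell^\alpha=\prod_i\ell_i^{\alpha_i}$. The *harmonic logarithm* of degree $a\in G$ and order $\alpha$ is $$\lambda_a^\alpha=\lfloor a\rceil!\;x^a\sum_{k\ge0}s(-a,k)\Big(x\frac{d}{dx}\Big)^k\ell^\alpha ,\qquad \sum_k s(a,k)y^k=\frac{\Gamma(y+1)}{\Gamma(y-a+1)} .$$ $\mathcal I^\alpha$ is the space of formal sums $\sum_{b\in G}c_b\lambda_b^\alpha$, $c_b\in\mathbb C$, with Noetherian support (each nonempty subset of the support has a largest element), and $\langle\,\cdot\,\rangle_\alpha$ is the coefficient of $\lambda_0^\alpha$. An *Artinian operator* is a formal sum $f(D)=\sum_{b\in G}f_bD^b$, $f_b\in\mathbb C$, with well-ordered support; it acts by $D^b\lambda_a^\alpha=\frac{\lfloor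 a\rceil!}{\lfloor a-b\rceil!}\lambda_{a-b}^\alpha$ (for $\alpha=(0)$ only operators with nonnegative exponents are used). It is a *delta operator* if its lowest term is $f_1D$, $f_1\ne0$. For a delta operator $f=cD(1+h)$, with $h$ of positive degree, in the continuous case put $f^{a;n}=e^{a(\log c+2\pi i n)}D^a\sum_k\binom ak h^k$ with the principal logarithm $-\pi<\operatorname{Im}\log c\le\pi$; in the discrete case use ordinary integer powers. Let $g(f)=\sum_bg_bf^b$ (discrete), $g(f;0)=\sum_bg_bf^{b;0}$ (continuous). Below $\alpha$ ranges over all orders in the discrete case, and over all nonzero orders in the continuous case. A *graded sequence* $(p_a^\alpha)$ has $p_a^\alpha\in\mathcal I^\alpha$, with no terms of degree above $a$ and nonzero coefficient of $\lambda_a^\alpha$ (whenever $\lambda_a^\alpha\neq0$), and $\lambda_a^\alpha\mapsto p_a^\alpha$ extends to all Noetherian sums. It is the *associated sequence* of $f(D)$ (discrete), resp. the *$n$-th associated sequence* (continuous), if $\langle f(D)^{b}p_a^\alpha\rangle_\alpha=\lfloor a\rceil!\,\delta_{ab}$, resp. $\langle f(D)^{b;n}p_a^\alpha\rangle_\alpha=\lfloor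 a\rceil!\,\delta_{ab}$, for all $a,b\in G$ (only $b\ge0$ when $\alpha=(0)$). The *standard* associated sequence is the associated sequence in the discrete case and the $0$-th one in the continuous case. A *Roman graded sequence* is a graded sequence that is regular (the coefficients of $p_a^\alpha$ at nonvanishing harmonic logarithms do not depend on $\alpha$) and of binomial type: for all Artinian $f,g$, all $a$, and all $\alpha\neq(0)$, $$\langle f(D)g(D)p_a^\alpha\rangle_\alpha=\sum_b\frac{\lfloor a\rceil!}{\lfloor b\rceil!\lfloor a-b\rceil!}\langle f(D)p_b^\alpha\rangle_\alpha\langle g(D)p_{a-b}^\alpha\rangle_\alpha \quad\text{(a finite sum)}.$$ In the continuous case, a delta operator is *standard* if its leading coefficient is a positive real, and a *standard Roman graded sequence* is the standard associated sequence of a standard delta operator. The *umbral composition* is $q_a^\alpha(\mathbf p)=\sum_b c_{ab}^\alpha\,p_b^\alpha$, where $c^\alpha_{ab}$ is the coefficient of $\lambda_b^\alpha$ in $q_a^\alpha$. **Proposition.** Let $\mathbf p$ and $\mathbf q$ be the standard associated graded sequences of the delta operators $f(D)$ and $g(D)$ respectively. In the continuous case assume that $\arg f_1+\arg g_1\in(-\pi,\pi]$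 (principal arguments of the leading coefficients), which holds in particular if both operators are standard. Then the sums defining $q_a^\alpha(\mathbf p)$ converge, the composition $g(f)$ (resp. $g(f;0)$) converges and is a delta operator, its standard associated graded sequence is $q_a^\alpha(\mathbf p)$, and it is the only delta operator with this standard associated sequence. **Corollary.** In the discrete and in the continuous case, the set of Roman graded sequences is closed under umbral composition. In the continuous case, so are the set of all sequences that are the $n$-th associated sequence of some delta operator for some $n\in\mathbb Z$, and the set of standard Roman graded sequences. (In all these cases the sums defining the umbral composition converge.) -/

import Mathlib

open scoped BigOperators

noncomputable section

namespace RomanUmbral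

/-! ### Roman factorials and Stirling numbers -/

/-- The Roman factorial: `Γ(a+1)` unless `a` is a negative integer, and
`(-1)^(a+1) / (-a-1)!` for a negative integer `a`. -/
def romanFactorial (a : ℝ) : ℝ :=
  open Classical in
  if ∃ n : ℕ, a = -((n : ℝ) + 1) then
    (-1) ^ ⌊-a - 1⌋₊ / (Nat.factorial ⌊-a - 1⌋₊ : ℝ)
  else Real.Gamma (a + 1)

/-- The Roman (binomial) coefficient. -/
def romanCoeff (a b : ℝ) : ℝ :=
  romanFactorial a / (romanFactorial b * romanFactorial (a - b))

/-- The Stirling numbers of the first kind with real upper index: the coefficient of `y ^ k` in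
the Taylor expansion at `0` of the lower factorial `Γ(y + 1) / Γ(y - a + 1)`.
Mathlib's value `Γ = 0` at the poles makes the reciprocal of `Γ` the usual entire function. -/
def stirling (a : ℝ) (k : ℕ) : ℂ :=
  iteratedDeriv k (fun y : ℂ => Complex.Gamma (y + 1) * (Complex.Gamma (y - a + 1))⁻¹) 0 /
    (Nat.factorial k : ℂ)

/-! ### Formal series of logarithmic type

`G` is the group of exponents of `x`: the integers (discrete case) or the reals (continuous case).
The iterated logarithms are `ℓ 0 = log x`, `ℓ 1 = log log x`, and so on. A pair `(b, β)` stands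
for the monomial `x ^ b * (ℓ 0) ^ (β 0) * (ℓ 1) ^ (β 1) * ...`. -/

/-- Exponent vectors of the iterated logarithms; they are also the orders of harmonic logarithms. -/
abbrev LogExponent : Type := ℕ →₀ ℤ

/-- Formal complex combinations of the monomials `(b, β)`; the subspaces used below carry
the Noetherian support condition. -/
abbrev LogSeries (G : Type) : Type := G × LogExponent → ℂ

/-- The Euler derivation `x d/dx` on Laurent polynomials in the iterated logarithms:
`x d/dx (ℓ i) = 1 / (ℓ 0 * ... * ℓ (i-1))`. -/
def logEuler : (LogExponent →₀ ℂ) →ₗ[ℂ] (LogExponent →₀ ℂ) :=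
  Finsupp.linearCombination ℂ fun β : LogExponent =>
    ∑ i ∈ β.support,
      Finsupp.single (β - ∑ j ∈ Finset.range (i + 1), Finsupp.single j (1 : ℤ)) ((β i : ℤ) : ℂ)

section Series

variable {G : Type} [CommRing G] [LinearOrder G] [IsStrictOrderedRing G] [Algebra G ℝ]

/-- The harmonic logarithm of degree `a` and order `α`:
`⌊a⌉! * x ^ a * ∑ k, s(-a, k) * (x d/dx) ^ k (ℓ ^ α)`. Each coefficient of this sum over `k`
has at most one nonzero term, as `x d/dx` lowers the exponent of `ℓ 0` by one. -/
def harmonicLog (a : G) (α : LogExponent) : LogSeries G := fun m =>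
  open Classical in
  if m.1 = a then
    (romanFactorial (algebraMap G ℝ a) : ℂ) *
      ∑ᶠ k : ℕ, stirling (-(algebraMap G ℝ a)) k *
        ((logEuler ^ k) (Finsupp.single α 1)) m.2
  else 0

/-- `c` is the family of coefficients of `p` in an expansion `p = ∑ b, c b * λ_b^α` whose support
is Noetherian (every nonempty subset has a greatest element). Coefficients of the harmonic
logarithms that vanish (order zero, negative integer degree) are normalized to zero. The value of
the sum at a monomial `m` involves only the harmonic logarithm of degree `m.1`. -/
def IsExpansion (α : LogExponent) (c : HahnSeries Gᵒᵈ ℂ) (p : LogSeries G) : Prop :=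
  (∀ b : G, harmonicLog b α = 0 → c.coeff (OrderDual.toDual b) = 0) ∧
    ∀ m : G × LogExponent, p m = c.coeff (OrderDual.toDual m.1) * harmonicLog m.1 α m

/-- The space of formal power series of logarithmic type of order `α`. -/
def OrderSpace (α : LogExponent) : Set (LogSeries G) := {p | ∃ c, IsExpansion α c p}

/-- The (Noetherian) series of coefficients of an element of `OrderSpace α`. -/
def coords (α : LogExponent) (p : LogSeries G) : HahnSeries Gᵒᵈ ℂ :=
  open Classical in
  if h : ∃ c, IsExpansion α c p then h.choose else 0

/-- The coefficient of `λ_b^α` in `p`. -/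
def lcoeff (α : LogExponent) (b : G) (p : LogSeries G) : ℂ :=
  (coords α p).coeff (OrderDual.toDual b)

/-- The augmentation: the coefficient of `λ_0^α`. -/
def augmentation (α : LogExponent) (p : LogSeries G) : ℂ := lcoeff α 0 p

/-! ### Artinian operators

An Artinian operator `f(D) = ∑ b, f_b D^b` is a Hahn series over the exponents (its support is
well ordered). -/

/-- The action of `f(D)` on series of order `α`, by `D^b λ_a^α = (⌊a⌉! / ⌊a-b⌉!) λ_{a-b}^α`. -/
def applyOp (f : HahnSeries G ℂ) (α : LogExponent) (p : LogSeries G) : LogSeries G := fun m =>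
  (∑ᶠ b : G, f.coeff b * lcoeff α (m.1 + b) p *
      ((romanFactorial (algebraMap G ℝ (m.1 + b)) / romanFactorial (algebraMap G ℝ m.1) : ℝ) : ℂ)) *
    harmonicLog m.1 α m

/-- Delta operators: Artinian operators of degree one. -/
def IsDelta (f : HahnSeries G ℂ) : Prop := f.coeff 1 ≠ 0 ∧ ∀ b < 1, f.coeff b = 0

/-- `h = ∑ b, g_b P_b` (a convergent sum of Hahn series): the composition of `g` with the series
whose powers are the `P_b`. -/
def IsComposition (g : HahnSeries G ℂ) (P : G → HahnSeries G ℂ) (h : HahnSeries G ℂ) : Prop :=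
  ∃ s : HahnSeries.SummableFamily G ℂ G, (∀ b, s b = g.coeff b • P b) ∧ s.hsum = h

/-! ### Graded sequences

Sequences `p_a^α` are indexed by the orders `α` in a set `A` (all orders in the discrete case, all
nonzero orders in the continuous case) and the degrees `a : G`. -/

/-- Graded sequences: `p_a^α` has order `α` and degree `a`, and `λ_a^α ↦ p_a^α` extends to
Noetherian sums. -/
def IsGraded (A : Set LogExponent) (p : LogExponent → G → LogSeries G) : Prop :=
  ∀ α ∈ A,
    (∀ a, p α a ∈ OrderSpace α) ∧
    (∀ a b, a < b → lcoeff α b (p α a) = 0) ∧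
    (∀ a : G, harmonicLog a α ≠ 0 → lcoeff α a (p α a) ≠ 0) ∧
    (∀ c : HahnSeries Gᵒᵈ ℂ, ∃ s : HahnSeries.SummableFamily Gᵒᵈ ℂ G,
      ∀ a, s a = c.coeff (OrderDual.toDual a) • coords α (p α a))

/-- Regularity: the coefficients of `p_a^α` do not depend on the order. -/
def IsRegular (A : Set LogExponent) (p : LogExponent → G → LogSeries G) : Prop :=
  ∀ α ∈ A, ∀ β ∈ A, ∀ a b : G, harmonicLog b α ≠ 0 → harmonicLog b β ≠ 0 →
    lcoeff α b (p α a) = lcoeff β b (p β a)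

/-- `p` is the graded sequence associated with the delta operator whose powers are `P b`:
`⟨P_b p_a^α⟩_α = ⌊a⌉! δ_{ab}`. On series of order zero only the differential operators
(nonnegative exponents) act. -/
def IsAssociated (A : Set LogExponent) (P : G → HahnSeries G ℂ)
    (p : LogExponent → G → LogSeries G) : Prop :=
  IsGraded A p ∧
    ∀ α ∈ A, ∀ a b : G, (α = 0 → 0 ≤ b) →
      augmentation α (applyOp (P b) α (p α a)) =
        open Classical in
        if a = b then (romanFactorial (algebraMap G ℝ a) : ℂ) else 0

/-- Roman graded sequences: regular graded sequences of binomial type, that is,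
`⟨f(D) g(D) p_a^α⟩_α = ∑ b, ⌊a b⌉ ⟨f(D) p_b^α⟩_α ⟨g(D) p_{a-b}^α⟩_α` (a finite sum) for all
Artinian operators `f(D)`, `g(D)`. -/
def IsRoman (A : Set LogExponent) (p : LogExponent → G → LogSeries G) : Prop :=
  IsGraded A p ∧ IsRegular A p ∧
    ∀ α ∈ A, α ≠ 0 → ∀ (a : G) (f g : HahnSeries G ℂ),
      {b : G | augmentation α (applyOp f α (p α b)) *
        augmentation α (applyOp g α (p α (a - b))) ≠ 0}.Finite ∧
      augmentation α (applyOp (f * g) α (p α a)) =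
        ∑ᶠ b : G, (romanCoeff (algebraMap G ℝ a) (algebraMap G ℝ b) : ℂ) *
          (augmentation α (applyOp f α (p α b)) *
            augmentation α (applyOp g α (p α (a - b))))

/-- The umbral composition `q_a^α(p) = ∑ b, c_{ab}^α p_b^α`, where `c_{ab}^α` is the coefficient
of `λ_b^α` in `q_a^α`. -/
def umbralComp (q p : LogExponent → G → LogSeries G) : LogExponent → G → LogSeries G :=
  fun α a m => ∑ᶠ b : G, lcoeff α b (q α a) * p α b m

/-- The sums that define the umbral composition converge. -/
def UmbralConverges (A : Set LogExponent) (q p : LogExponent → G → LogSeries G) : Prop :=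
  ∀ α ∈ A, ∀ (a : G) (m : G × LogExponent), {b : G | lcoeff α b (q α a) * p α b m ≠ 0}.Finite

end Series

/-! ### The two cases -/

/-- Discrete case: integer exponents, all orders, integer powers in the field of formal
Laurent series. -/
def DiscreteAssociated (f : HahnSeries ℤ ℂ) (p : LogExponent → ℤ → LogSeries ℤ) : Prop :=
  IsAssociated Set.univ (fun b : ℤ => f ^ b) p

/-- The `n`-th branch of the real power `f^{a;n}` of a nonzero Artinian series: if
`f = c x^d (1 + h)` with `h` of positive degree, it is
`exp (a (log c + 2πin)) x^{ad} ∑ k, (a choose k) h^k`, with the principal logarithm. -/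
def branchPow (n : ℤ) (f : HahnSeries ℝ ℂ) (a : ℝ) : HahnSeries ℝ ℂ :=
  HahnSeries.single (a * f.order)
      (Complex.exp ((a : ℂ) * (Complex.log f.leadingCoeff + 2 * Real.pi * Complex.I * n))) *
    PowerSeries.heval (HahnSeries.single (-f.order) (f.leadingCoeff)⁻¹ * f - 1)
      (PowerSeries.binomialSeries ℂ (a : ℂ))

/-- The nonzero orders. -/
def nonzeroOrders : Set LogExponent := {α | α ≠ 0}

/-- Continuous case: real exponents, nonzero orders, `n`-th associated sequences. The standard
associated sequence is the one with `n = 0`. -/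
def ContinuousAssociated (n : ℤ) (f : HahnSeries ℝ ℂ) (p : LogExponent → ℝ → LogSeries ℝ) : Prop :=
  IsAssociated nonzeroOrders (branchPow n f) p

/-- Standard delta operators: the leading coefficient is a positive real number. -/
def IsStandardDelta (f : HahnSeries ℝ ℂ) : Prop :=
  IsDelta f ∧ ∃ c : ℝ, 0 < c ∧ f.coeff 1 = (c : ℂ)

/-- Standard Roman graded sequences: the standard associated sequences of standard
delta operators. -/
def IsStandardRoman (p : LogExponent → ℝ → LogSeries ℝ) : Prop :=
  ∃ f, IsStandardDelta f ∧ ContinuousAssociated 0 f p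

end RomanUmbral

end

/-!
Fix an order `α` and a graded sequence `p`, and write `⌊a⌉!` for the Roman factorial. Only the
coefficients of `p_a^α` at the harmonic logarithms matter, and `⟨f(D) p_a^α⟩_α` is the pairing
`∑ b, f_b c_b ⌊b⌉!` of `f` with the coordinates `c` of `p_a^α` (`augmentation_applyOp`). The linear
map `λ_a ↦ p_a` therefore has an adjoint `f ↦ ∑ a, (⟨f(D) p_a⟩ / ⌊a⌉!) D^a`. Because the linear map
extends to Noetherian sums, the adjoint takes Artinian series to Artinian series
(`RowSummable.adjoint`). Umbral composition `q(p)` composes the two linear maps, so its adjoint is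
the adjoint of `q` after the adjoint of `p` (`IsGraded.adjoint_umbralComp`).

In these terms, a sequence is of binomial type exactly when its adjoint is multiplicative
(`IsGraded.binomial_iff`), a property that is stable under composition; regularity is inherited
because the coefficient of `λ_b` in `q_a(p)` uses only intermediate degrees between `b` and `a`, and
because harmonic logarithms of nonzero order do not vanish (`harmonicLog_ne_zero`). This gives the
statements on Roman graded sequences without any delta operator.

A sequence is associated with the powers `P b` of a delta operator when its adjoint sends `P b`
to `D^b`, so the adjoint inverts the composition map `k ↦ ∑ b, k_b P_b`
(`RowSummable.adjoint_powerFamily_comp`). Hence `q(p)` is associated with the family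
`b ↦ g^b(f)` (`IsAssociated.umbralComp`), and it remains to identify `g^b(f)` with `g(f)^b`.
Composition with `f` is a ring homomorphism (`IsPowerFamily.compHom`), which settles integer powers.
For real powers it also commutes with infinite sums of powers, and the identity
`(1 + x)^a (1 + y)^a = ((1 + x)(1 + y))^a` holds since both sides have coefficients polynomial
in `a` and agree for natural numbers `a` (`onePlusPow_mul`); the leading coefficients match on the branch
where the logarithms add up (`IsDelta.comp_branchPow`). Uniqueness of the delta operator is the
injectivity of the adjoint (`IsGraded.adjoint_injective`).
-/

noncomputable section

namespace RomanUmbral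

open OrderDual

/-! ### Finite sums over well-ordered supports -/

/-- A well-ordered set and a Noetherian set have finite intersection. -/
theorem finite_setOf_mem_and_toDual_mem {G : Type*} [LinearOrder G] {s : Set G} {t : Set Gᵒᵈ}
    (hs : s.IsPWO) (ht : t.IsPWO) : {b : G | b ∈ s ∧ toDual b ∈ t}.Finite := by
  by_contra h
  -- an injective sequence would have a subsequence both monotone and antitone
  let u := Set.Infinite.natEmbedding _ h
  obtain ⟨g, hg⟩ := hs.exists_monotone_subseq (f := fun n => (u n : G)) (fun n => (u n).2.1)
  obtain ⟨k, hk⟩ := ht.exists_monotone_subseq (f := fun n => toDual (u (g n) : G))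
    (fun n => (u (g n)).2.2)
  have h1 : (u (g (k 0)) : G) ≤ u (g (k 1)) := hg (k.monotone zero_le_one)
  have h2 : toDual (u (g (k 0)) : G) ≤ toDual (u (g (k 1)) : G) := hk zero_le_one
  have h3 : (u (g (k 0)) : G) = u (g (k 1)) := le_antisymm h1 (toDual_le_toDual.1 h2)
  have h4 := k.injective (g.injective (u.injective (Subtype.ext h3)))
  exact zero_ne_one h4

theorem finsum_comm_of_finite {X Y : Type*} (F : X → Y → ℂ)
    (h : {p : X × Y | F p.1 p.2 ≠ 0}.Finite) :
    ∑ᶠ x, ∑ᶠ y, F x y = ∑ᶠ y, ∑ᶠ x, F x y := by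
  have h1 := finsum_curry (fun p : X × Y => F p.1 p.2) h
  have h' : {p : Y × X | F p.2 p.1 ≠ 0}.Finite :=
    (h.image Prod.swap).subset fun p hp => ⟨p.swap, hp, rfl⟩
  have h2 := finsum_curry (fun p : Y × X => F p.2 p.1) h'
  rw [← h1, ← h2, ← finsum_comp_equiv (Equiv.prodComm X Y)]
  rfl

theorem orderTop_pos_of_forall_le {G : Type*} [AddCommGroup G] [LinearOrder G]
    {x : HahnSeries G ℂ} (h : ∀ d ≤ 0, x.coeff d = 0) :
    0 < x.orderTop := by
  by_contra hx
  rw [not_lt] at hx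
  have hne : x ≠ 0 := by
    rintro rfl
    simp at hx
  rw [← HahnSeries.order_eq_orderTop_of_ne_zero hne] at hx
  have := h x.order (by exact_mod_cast hx)
  exact hne (HahnSeries.coeff_order_eq_zero.1 this)

theorem coeff_eq_zero_of_orderTop_pos {G : Type*} [AddCommGroup G] [LinearOrder G]
    {x : HahnSeries G ℂ} (h : 0 < x.orderTop) {d : G}
    (hd : d ≤ 0) : x.coeff d = 0 :=
  HahnSeries.coeff_eq_zero_of_lt_orderTop (lt_of_le_of_lt (by exact_mod_cast hd) h)

section Hahn

variable {G : Type*} [AddCommGroup G] [LinearOrder G] [IsOrderedAddMonoid G]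

theorem finite_setOf_mem_and_sub_mem {s t : Set G} (hs : s.IsPWO) (ht : t.IsPWO) (d : G) :
    {b : G | b ∈ s ∧ d - b ∈ t}.Finite := by
  refine ((Set.AddAntidiagonal.finite_of_isPWO hs ht d).image Prod.fst).subset ?_
  rintro b ⟨hb, hb'⟩
  exact ⟨(b, d - b), ⟨hb, hb', by simp⟩, rfl⟩

theorem finite_mul_support (x y : HahnSeries G ℂ) (a : G) :
    {b : G | x.coeff b * y.coeff (a - b) ≠ 0}.Finite :=
  (finite_setOf_mem_and_sub_mem x.isPWO_support y.isPWO_support a).subset fun _ hb =>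
    ⟨left_ne_zero_of_mul hb, right_ne_zero_of_mul hb⟩

theorem coeff_mul_eq_finsum (x y : HahnSeries G ℂ) (a : G) :
    (x * y).coeff a = ∑ᶠ b : G, x.coeff b * y.coeff (a - b) := by
  classical
  have hinj : Set.InjOn Prod.fst
      (Finset.antidiagonal x.isPWO_support y.isPWO_support a : Set (G × G)) := by
    rintro ⟨b, c⟩ h ⟨b', c'⟩ h' rfl
    rw [Finset.mem_coe, Finset.mem_antidiagonal] at h h'
    simpa using add_left_cancel (h.2.2.trans h'.2.2.symm)
  rw [HahnSeries.coeff_mul, finsum_eq_sum_of_support_subset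
    (s := (Finset.antidiagonal x.isPWO_support y.isPWO_support a).image Prod.fst),
    Finset.sum_image hinj]
  · refine Finset.sum_congr rfl ?_
    rintro ⟨b, c⟩ h
    rw [Finset.mem_antidiagonal] at h
    simp [← h.2.2]
  · intro b hb
    simp only [Finset.coe_image, Set.mem_image, Finset.mem_coe, Finset.mem_antidiagonal]
    exact ⟨(b, a - b), ⟨left_ne_zero_of_mul hb, right_ne_zero_of_mul hb, by simp⟩, rfl⟩

/-! ### Composition of Hahn series -/

/-- A family of Hahn series that behaves like the powers `f ^ b` of a delta operator:
multiplicative in `b`, with the support of `P b` contained in `b + S` for a fixed well-ordered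
set `S` of nonnegative exponents. -/
structure IsPowerFamily (P : G → HahnSeries G ℂ) (S : Set G) : Prop where
  isPWO : S.IsPWO
  nonneg : ∀ s ∈ S, 0 ≤ s
  map_zero : P 0 = 1
  map_add : ∀ a b, P (a + b) = P a * P b
  support : ∀ b d, (P b).coeff d ≠ 0 → d - b ∈ S

variable {P : G → HahnSeries G ℂ} {S : Set G}

theorem IsPowerFamily.le_of_coeff_ne_zero (hP : IsPowerFamily P S) {b d : G}
    (h : (P b).coeff d ≠ 0) : b ≤ d :=
  sub_nonneg.1 (hP.nonneg _ (hP.support b d h))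

theorem IsPowerFamily.finite_support (hP : IsPowerFamily P S) (k : HahnSeries G ℂ) (d : G) :
    {b : G | k.coeff b * (P b).coeff d ≠ 0}.Finite :=
  (finite_setOf_mem_and_sub_mem k.isPWO_support hP.isPWO d).subset fun b hb =>
    ⟨left_ne_zero_of_mul hb, hP.support b d (right_ne_zero_of_mul hb)⟩

/-- The summable family `b ↦ k_b P_b`. -/
def IsPowerFamily.family (hP : IsPowerFamily P S) (k : HahnSeries G ℂ) :
    HahnSeries.SummableFamily G ℂ G where
  toFun b := k.coeff b • P b
  isPWO_iUnion_support' := by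
    refine (k.isPWO_support.add hP.isPWO).mono ?_
    intro d hd
    obtain ⟨b, hb⟩ := Set.mem_iUnion.1 hd
    have hb' : k.coeff b * (P b).coeff d ≠ 0 := by simpa using hb
    exact Set.mem_add.2 ⟨b, left_ne_zero_of_mul hb', d - b,
      hP.support b d (right_ne_zero_of_mul hb'), by simp⟩
  finite_co_support' d := by simpa using hP.finite_support k d

/-- The composition `∑ b, k_b P_b`. -/
def IsPowerFamily.comp (hP : IsPowerFamily P S) (k : HahnSeries G ℂ) : HahnSeries G ℂ :=
  (hP.family k).hsum

theorem IsPowerFamily.coeff_comp (hP : IsPowerFamily P S) (k : HahnSeries G ℂ) (d : G) :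
    (hP.comp k).coeff d = ∑ᶠ b : G, k.coeff b * (P b).coeff d := by
  simp [IsPowerFamily.comp, IsPowerFamily.family]

theorem IsPowerFamily.comp_single (hP : IsPowerFamily P S) (b : G) (r : ℂ) :
    hP.comp (HahnSeries.single b r) = r • P b := by
  ext d
  rw [hP.coeff_comp, finsum_eq_single _ b]
  · simp
  · intro c hc
    simp [HahnSeries.coeff_single_of_ne hc]

theorem IsPowerFamily.comp_add (hP : IsPowerFamily P S) (k l : HahnSeries G ℂ) :
    hP.comp (k + l) = hP.comp k + hP.comp l := by
  ext d
  rw [HahnSeries.coeff_add, hP.coeff_comp, hP.coeff_comp, hP.coeff_comp,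
    ← finsum_add_distrib (hP.finite_support k d) (hP.finite_support l d)]
  simp [add_mul]

theorem IsPowerFamily.comp_mul (hP : IsPowerFamily P S) (k l : HahnSeries G ℂ) :
    hP.comp (k * l) = hP.comp k * hP.comp l := by
  ext d
  have hfam : ∀ p : G × G, ((hP.family k).mul (hP.family l) p).coeff d =
      k.coeff p.1 * l.coeff p.2 * (P (p.1 + p.2)).coeff d := by
    intro p
    change ((k.coeff p.1 • P p.1) * (l.coeff p.2 • P p.2)).coeff d = _
    rw [hP.map_add, ← HahnSeries.single_zero_mul_eq_smul, ← HahnSeries.single_zero_mul_eq_smul,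
      mul_mul_mul_comm, HahnSeries.single_mul_single, add_zero,
      HahnSeries.single_zero_mul_eq_smul, HahnSeries.coeff_smul, smul_eq_mul]
  have hfin := ((hP.family k).mul (hP.family l)).finite_co_support' d
  -- the substitution `(c, b) ↦ (b, c - b)` turns the double sum into the product
  let e : G × G ≃ G × G :=
    { toFun := fun p => (p.2, p.1 - p.2)
      invFun := fun p => (p.1 + p.2, p.1)
      left_inv := fun p => by simp
      right_inv := fun p => by simp }
  rw [show hP.comp k * hP.comp l = ((hP.family k).mul (hP.family l)).hsum from
      (HahnSeries.SummableFamily.hsum_mul _ _).symm, HahnSeries.SummableFamily.coeff_hsum,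
    ← finsum_comp_equiv e, finsum_curry]
  · rw [hP.coeff_comp]
    refine finsum_congr fun c => ?_
    rw [coeff_mul_eq_finsum, finsum_mul]
    refine finsum_congr fun b => ?_
    rw [hfam]
    simp [e]
  · exact (hfin.preimage e.injective.injOn)

/-- Composition as a ring homomorphism. -/
def IsPowerFamily.compHom (hP : IsPowerFamily P S) : HahnSeries G ℂ →+* HahnSeries G ℂ where
  toFun := hP.comp
  map_one' := by
    rw [← HahnSeries.single_zero_one, hP.comp_single, hP.map_zero, one_smul]; rfl
  map_mul' := hP.comp_mul
  map_zero' := by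
    ext d
    simp [hP.coeff_comp]
  map_add' := hP.comp_add

theorem IsPowerFamily.exists_le_of_coeff_comp_ne_zero (hP : IsPowerFamily P S)
    {k : HahnSeries G ℂ} {d : G} (h : (hP.comp k).coeff d ≠ 0) :
    ∃ b ≤ d, k.coeff b ≠ 0 := by
  rw [hP.coeff_comp] at h
  obtain ⟨b, hb⟩ := not_forall.1 (mt finsum_eq_zero_of_forall_eq_zero h)
  exact ⟨b, hP.le_of_coeff_ne_zero (right_ne_zero_of_mul hb), left_ne_zero_of_mul hb⟩

theorem IsPowerFamily.coeff_comp_of_forall_lt (hP : IsPowerFamily P S)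
    {k : HahnSeries G ℂ} {d : G} (h : ∀ b < d, k.coeff b = 0) :
    (hP.comp k).coeff d = k.coeff d * (P d).coeff d := by
  rw [hP.coeff_comp, finsum_eq_single _ d]
  intro b hb
  rcases lt_or_gt_of_ne hb with hlt | hgt
  · simp [h b hlt]
  · by_contra hne
    exact (hP.le_of_coeff_ne_zero (right_ne_zero_of_mul hne)).not_gt hgt

theorem IsPowerFamily.orderTop_comp_pos (hP : IsPowerFamily P S) {x : HahnSeries G ℂ}
    (hx : 0 < x.orderTop) : 0 < (hP.comp x).orderTop := by
  refine orderTop_pos_of_forall_le fun d hd => ?_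
  by_contra h
  obtain ⟨b, hb, hb'⟩ := hP.exists_le_of_coeff_comp_ne_zero h
  exact hb' (coeff_eq_zero_of_orderTop_pos hx (hb.trans hd))

theorem coeff_heval_eq_finsum {x : HahnSeries G ℂ} (hx : 0 < x.orderTop) (F : PowerSeries ℂ)
    (d : G) : (PowerSeries.heval x F).coeff d = ∑ᶠ n : ℕ, F.coeff n * (x ^ n).coeff d := by
  rw [PowerSeries.coeff_heval]
  refine finsum_congr fun n => ?_
  simp [hx]

/-- Composition is compatible with infinite sums of powers. -/
theorem IsPowerFamily.comp_heval (hP : IsPowerFamily P S) {x : HahnSeries G ℂ}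
    (hx : 0 < x.orderTop) (F : PowerSeries ℂ) :
    hP.comp (PowerSeries.heval x F) = PowerSeries.heval (hP.comp x) F := by
  ext d
  have hpow : ∀ n : ℕ, hP.comp x ^ n = hP.comp (x ^ n) := fun n =>
    (map_pow hP.compHom x n).symm
  rw [coeff_heval_eq_finsum (hP.orderTop_comp_pos hx), hP.coeff_comp]
  simp only [coeff_heval_eq_finsum hx, hpow, hP.coeff_comp]
  simp only [finsum_mul, mul_finsum]
  rw [finsum_comm_of_finite]
  · simp only [mul_assoc]
  · have h1 := finite_setOf_mem_and_sub_mem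
      (HahnSeries.SummableFamily.isPWO_iUnion_support_powers
        (HahnSeries.zero_le_orderTop_iff.1 hx.le)) hP.isPWO d
    refine ((h1.biUnion (t := fun b => (fun n : ℕ => (b, n)) '' {n | (x ^ n).coeff b ≠ 0})
      fun b _ => ?_)).subset ?_
    · exact (HahnSeries.SummableFamily.pow_finite_co_support hx b).image _
    · rintro ⟨b, n⟩ hbn
      have h2 := left_ne_zero_of_mul hbn
      have h3 := hP.support b d (right_ne_zero_of_mul hbn)
      have h4 := right_ne_zero_of_mul h2
      refine Set.mem_iUnion.2 ?_
      exact ⟨b, Set.mem_iUnion.2 ⟨⟨Set.mem_iUnion.2 ⟨n, h4⟩, h3⟩, n, h4, rfl⟩⟩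

end Hahn

/-! ### Roman factorials and nonvanishing of the harmonic logarithms -/

theorem romanFactorial_ne_zero (a : ℝ) : romanFactorial a ≠ 0 := by
  unfold romanFactorial
  split_ifs with h
  · exact div_ne_zero (pow_ne_zero _ (by norm_num)) (by positivity)
  · refine Real.Gamma_ne_zero fun m hm => h ⟨m, ?_⟩
    linarith

theorem romanFactorial_zero : romanFactorial 0 = 1 := by
  unfold romanFactorial
  rw [if_neg]
  · simp
  · rintro ⟨n, hn⟩
    have : (0 : ℝ) ≤ n := n.cast_nonneg
    linarith

theorem stirling_neg_zero (a : ℝ) : stirling (-a) 0 = (Complex.Gamma (a + 1))⁻¹ := by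
  simp [stirling]

theorem stirling_neg_zero_ne_zero {a : ℝ} (ha : ∀ n : ℕ, a ≠ -((n : ℝ) + 1)) :
    stirling (-a) 0 ≠ 0 := by
  rw [stirling_neg_zero]
  refine inv_ne_zero (Complex.Gamma_ne_zero fun m hm => ha m ?_)
  have h : ((a + 1 : ℝ) : ℂ) = ((-m : ℝ) : ℂ) := by
    push_cast
    exact hm
  have := Complex.ofReal_injective h
  linarith

theorem Gamma_add_one_eq_prod (n : ℕ) {y : ℂ} (hy : ∀ m : ℤ, y ≠ m) :
    Complex.Gamma (y + 1) =
      (∏ i ∈ Finset.range n, (y - i)) * Complex.Gamma (y - n + 1) := by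
  induction n with
  | zero => simp
  | succ n ih =>
    have h : y - n ≠ 0 := fun h => hy n (by simpa using sub_eq_zero.1 h)
    rw [ih, Complex.Gamma_add_one _ h, Finset.prod_range_succ, mul_assoc]
    push_cast
    ring_nf

/-- Near `0` the lower factorial of positive integer index is a polynomial. -/
theorem Gamma_mul_inv_Gamma_eventuallyEq (n : ℕ) :
    (fun y : ℂ => Complex.Gamma (y + 1) * (Complex.Gamma (y - (n + 1 : ℕ) + 1))⁻¹) =ᶠ[nhds 0]
      fun y => y * ∏ i ∈ Finset.range n, (y - (i + 1 : ℕ)) := by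
  filter_upwards [Metric.ball_mem_nhds (0 : ℂ) one_pos] with y hy
  rcases eq_or_ne y 0 with rfl | hy0
  · have h : (0 : ℂ) - (n + 1 : ℕ) + 1 = -(n : ℂ) := by
      push_cast
      ring
    rw [h, Complex.Gamma_neg_nat_eq_zero]
    simp
  have hint : ∀ m : ℤ, y ≠ m := by
    rintro m rfl
    have h1 : |(m : ℝ)| < 1 := by simpa using hy
    have h2 : |m| < 1 := by exact_mod_cast h1
    exact hy0 (by simp [Int.abs_lt_one_iff.1 h2])
  have hne : Complex.Gamma (y - (n + 1 : ℕ) + 1) ≠ 0 := by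
    refine Complex.Gamma_ne_zero fun m hm => hint (n - m) ?_
    push_cast at hm ⊢
    linear_combination hm
  rw [Gamma_add_one_eq_prod (n + 1) hint, mul_assoc, mul_inv_cancel₀ hne, mul_one,
    Finset.prod_range_succ', mul_comm]
  simp

theorem stirling_one_ne_zero (n : ℕ) : stirling ((n : ℝ) + 1) 1 ≠ 0 := by
  have h := Gamma_mul_inv_Gamma_eventuallyEq n
  have hQ : DifferentiableAt ℂ (fun y : ℂ => ∏ i ∈ Finset.range n, (y - (i + 1 : ℕ))) 0 := by
    fun_prop
  have hd : HasDerivAt (fun y : ℂ => y * ∏ i ∈ Finset.range n, (y - (i + 1 : ℕ))) _ 0 :=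
    (hasDerivAt_id (0 : ℂ)).mul hQ.hasDerivAt
  have hfun : (fun y : ℂ => Complex.Gamma (y + 1) *
      (Complex.Gamma (y - (((n : ℝ) + 1 : ℝ) : ℂ) + 1))⁻¹) =
      fun y : ℂ => Complex.Gamma (y + 1) * (Complex.Gamma (y - (n + 1 : ℕ) + 1))⁻¹ := by
    push_cast
    rfl
  have hval : deriv (fun y : ℂ => Complex.Gamma (y + 1) *
      (Complex.Gamma (y - (((n : ℝ) + 1 : ℝ) : ℂ) + 1))⁻¹) 0 =
      ∏ i ∈ Finset.range n, (0 - (i + 1 : ℕ) : ℂ) := by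
    rw [hfun, h.deriv_eq]
    simpa using hd.deriv
  rw [stirling, iteratedDeriv_one, hval]
  refine div_ne_zero (Finset.prod_ne_zero_iff.2 fun i _ => ?_) (by simp)
  rw [zero_sub, neg_ne_zero]
  exact_mod_cast i.succ_ne_zero

/-- The exponent vector of `ℓ 0 * ... * ℓ i`, by which the `i`-th term of the Euler derivation
shifts. -/
abbrev eulerShift (i : ℕ) : LogExponent :=
  ∑ j ∈ Finset.range (i + 1), Finsupp.single j (1 : ℤ)

theorem eulerShift_apply (i t : ℕ) : eulerShift i t = if t ≤ i then 1 else 0 := by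
  simp [eulerShift, Finsupp.finsetSum_apply, Finsupp.single_apply, Finset.sum_ite_eq']

theorem eulerShift_injective : Function.Injective eulerShift := by
  have key : ∀ i j : ℕ, eulerShift i = eulerShift j → i ≤ j := by
    intro i j h
    by_contra hij
    have := DFunLike.congr_fun h i
    simp [eulerShift_apply, hij] at this
  exact fun i j h => le_antisymm (key i j h) (key j i h.symm)

theorem logEuler_single (α : LogExponent) :
    logEuler (Finsupp.single α 1) =
      ∑ i ∈ α.support, Finsupp.single (α - eulerShift i) ((α i : ℤ) : ℂ) := by
  simp [logEuler, Finsupp.linearCombination_single]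

/-- The Euler derivation lowers the exponent of `ℓ 0` by one. -/
theorem apply_zero_of_logEuler_ne_zero {v : LogExponent →₀ ℂ} {z : ℤ}
    (hv : ∀ γ, v γ ≠ 0 → γ 0 = z) {β : LogExponent} (h : logEuler v β ≠ 0) : β 0 = z - 1 := by
  rw [logEuler, Finsupp.linearCombination_apply, Finsupp.sum, Finsupp.finsetSum_apply] at h
  obtain ⟨γ, hγ, hne⟩ := Finset.exists_ne_zero_of_sum_ne_zero h
  rw [Finsupp.smul_apply, Finsupp.finsetSum_apply] at hne
  obtain ⟨i, _, hi⟩ := Finset.exists_ne_zero_of_sum_ne_zero (right_ne_zero_of_smul hne)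
  have hβ : γ - eulerShift i = β := by
    by_contra hne'
    exact hi (Finsupp.single_eq_of_ne (Ne.symm hne'))
  rw [← hβ, Finsupp.sub_apply, eulerShift_apply, hv γ (Finsupp.mem_support_iff.1 hγ)]
  simp

theorem apply_zero_of_logEuler_pow_ne_zero (k : ℕ) {α β : LogExponent}
    (h : (logEuler ^ k) (Finsupp.single α 1) β ≠ 0) : β 0 = α 0 - k := by
  induction k generalizing β with
  | zero =>
    have : α = β := by
      by_contra hne
      exact h (Finsupp.single_eq_of_ne (Ne.symm hne))
    simp [this]
  | succ k ih =>
    rw [pow_succ', Module.End.mul_apply] at h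
    rw [apply_zero_of_logEuler_ne_zero (fun γ hγ => ih hγ) h]
    push_cast
    ring

theorem logEuler_single_apply_shift {α : LogExponent} {i : ℕ} :
    logEuler (Finsupp.single α 1) (α - eulerShift i) = ((α i : ℤ) : ℂ) := by
  rw [logEuler_single, Finsupp.finsetSum_apply, Finset.sum_eq_single i]
  · simp
  · intro j _ hj
    refine Finsupp.single_eq_of_ne fun h => hj ?_
    exact eulerShift_injective (sub_right_injective h).symm
  · intro hi
    simp [Finsupp.notMem_support_iff.1 hi]

section Series

variable {G : Type} [CommRing G] [Algebra G ℝ]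

/-- The Roman factorial of an exponent, as a complex number. -/
def rho (b : G) : ℂ := (romanFactorial (algebraMap G ℝ b) : ℂ)

theorem rho_ne_zero (b : G) : rho b ≠ 0 :=
  Complex.ofReal_ne_zero.2 (romanFactorial_ne_zero _)

theorem rho_mul_eq (a b : G) (x y : ℂ) :
    (romanCoeff (algebraMap G ℝ a) (algebraMap G ℝ b) : ℂ) *
      ((rho b * x) * (rho (a - b) * y)) = rho a * (x * y) := by
  have h : (romanCoeff (algebraMap G ℝ a) (algebraMap G ℝ b) : ℂ) =
      rho a / (rho b * rho (a - b)) := by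
    simp [romanCoeff, rho, map_sub]
  have h1 := rho_ne_zero b
  have h2 := rho_ne_zero (a - b)
  rw [h]
  field_simp

variable [LinearOrder G]

theorem harmonicLog_of_ne {a : G} {α : LogExponent} {m : G × LogExponent} (h : m.1 ≠ a) :
    harmonicLog a α m = 0 := by
  simp [harmonicLog, h]

/-- The coefficient sum of `λ_a^α` at a monomial whose `ℓ 0`-exponent is `α 0 - k` consists of
the `k`-th term alone. -/
theorem harmonicLog_apply_of_apply_zero (a : G) {α β : LogExponent} (k : ℕ)
    (h : β 0 = α 0 - k) :
    harmonicLog a α (a, β) =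
      rho a * (stirling (-(algebraMap G ℝ a)) k * (logEuler ^ k) (Finsupp.single α 1) β) := by
  rw [harmonicLog, if_pos rfl, finsum_eq_single _ k]
  · rfl
  · intro j hj
    by_contra hne
    have := apply_zero_of_logEuler_pow_ne_zero j (right_ne_zero_of_mul hne)
    refine hj ?_
    have h' : α 0 - (j : ℤ) = α 0 - k := this.symm.trans h
    omega

theorem harmonicLog_ne_zero_of_forall_ne {a : G} (α : LogExponent)
    (ha : ∀ n : ℕ, algebraMap G ℝ a ≠ -((n : ℝ) + 1)) : harmonicLog a α ≠ 0 := by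
  intro h
  have h1 := harmonicLog_apply_of_apply_zero a (α := α) (β := α) 0 (by simp)
  rw [h] at h1
  have h2 := mul_ne_zero (rho_ne_zero a) (stirling_neg_zero_ne_zero ha)
  simp only [Pi.zero_apply, pow_zero, Module.End.one_apply, Finsupp.single_eq_same,
    mul_one] at h1
  exact h2 h1.symm

theorem harmonicLog_zero_ne_zero (α : LogExponent) : harmonicLog (0 : G) α ≠ 0 := by
  refine harmonicLog_ne_zero_of_forall_ne α fun n hn => ?_
  have : (0 : ℝ) ≤ n := n.cast_nonneg
  rw [map_zero] at hn
  linarith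

/-- Harmonic logarithms of nonzero order never vanish: in negative integer degree the leading
term is killed by `1 / Γ`, and the term of `s(-a, 1)` survives. -/
theorem harmonicLog_ne_zero (a : G) {α : LogExponent} (hα : α ≠ 0) : harmonicLog a α ≠ 0 := by
  by_cases ha : ∀ n : ℕ, algebraMap G ℝ a ≠ -((n : ℝ) + 1)
  · exact harmonicLog_ne_zero_of_forall_ne α ha
  · push Not at ha
    obtain ⟨n, hn⟩ := ha
    obtain ⟨i, hi⟩ := Finsupp.support_nonempty_iff.2 hα
    intro h
    have h1 := harmonicLog_apply_of_apply_zero a (α := α) (β := α - eulerShift i) 1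
      (by rw [Finsupp.sub_apply, eulerShift_apply]; simp)
    rw [h, hn, neg_neg, pow_one, logEuler_single_apply_shift] at h1
    have h2 : ((α i : ℤ) : ℂ) ≠ 0 := Int.cast_ne_zero.2 (Finsupp.mem_support_iff.1 hi)
    exact mul_ne_zero (rho_ne_zero a) (mul_ne_zero (stirling_one_ne_zero n) h2) h1.symm

theorem harmonicLog_order_zero_of_neg {b : ℤ} (hb : b < 0) :
    harmonicLog b (0 : LogExponent) = 0 := by
  have hs : stirling (-(algebraMap ℤ ℝ b)) 0 = 0 := by
    obtain ⟨n, hn⟩ : ∃ n : ℕ, b + 1 = -(n : ℤ) := ⟨(-(b + 1)).toNat, by omega⟩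
    have hn' : (((algebraMap ℤ ℝ b : ℝ) : ℂ) + 1) = -(n : ℂ) := by
      rw [eq_intCast]
      exact_mod_cast congrArg (Int.cast : ℤ → ℂ) hn
    rw [stirling_neg_zero, hn', Complex.Gamma_neg_nat_eq_zero, inv_zero]
  have hE : logEuler (Finsupp.single (0 : LogExponent) 1) = 0 := by
    simp [logEuler_single]
  funext m
  by_cases hm : m.1 = b
  · have hz : ∀ k : ℕ, stirling (-(algebraMap ℤ ℝ b)) k *
        ((logEuler ^ k) (Finsupp.single (0 : LogExponent) 1)) m.2 = 0 := by
      intro k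
      cases k with
      | zero => rw [hs, zero_mul]
      | succ k => rw [pow_succ, Module.End.mul_apply, hE, map_zero]; simp
    rw [harmonicLog, if_pos hm, finsum_eq_zero_of_forall_eq_zero hz, mul_zero]
    rfl
  · rw [harmonicLog_of_ne hm]
    rfl

theorem harmonicLog_ne_zero_of_le_int {α : LogExponent} {b e : ℤ} (hbe : b ≤ e)
    (hb : harmonicLog b α ≠ 0) : harmonicLog e α ≠ 0 := by
  rcases eq_or_ne α 0 with rfl | hα
  · have hb0 : 0 ≤ b := by
      by_contra h
      exact hb (harmonicLog_order_zero_of_neg (not_le.1 h))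
    refine harmonicLog_ne_zero_of_forall_ne 0 fun n hn => ?_
    have h1 : (0 : ℝ) ≤ e := by exact_mod_cast hb0.trans hbe
    have h2 : (0 : ℝ) ≤ n := n.cast_nonneg
    rw [eq_intCast] at hn
    linarith
  · exact harmonicLog_ne_zero e hα

/-! ### Coordinates and the action of Artinian operators -/

variable {α : LogExponent} {p : LogSeries G} {c : HahnSeries Gᵒᵈ ℂ}

theorem IsExpansion.coords_eq (h : IsExpansion α c p) : coords α p = c := by
  have hex : ∃ c, IsExpansion α c p := ⟨c, h⟩
  have h' : IsExpansion α (coords α p) p := by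
    rw [coords, dif_pos hex]
    exact hex.choose_spec
  ext x
  obtain ⟨b, rfl⟩ := toDual.surjective x
  by_cases hb : harmonicLog b α = 0
  · rw [h.1 b hb, h'.1 b hb]
  · obtain ⟨m, hm⟩ := Function.ne_iff.1 hb
    have hmb : m.1 = b := by
      by_contra hne
      exact hm (harmonicLog_of_ne hne)
    have := (h'.2 m).symm.trans (h.2 m)
    rw [hmb] at this
    exact mul_right_cancel₀ hm this

theorem isExpansion_coords (h : p ∈ OrderSpace α) : IsExpansion α (coords α p) p := by
  obtain ⟨c, hc⟩ := h
  rwa [hc.coords_eq]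

theorem IsExpansion.lcoeff_eq (h : IsExpansion α c p) (b : G) :
    lcoeff α b p = c.coeff (toDual b) := by
  rw [lcoeff, h.coords_eq]

theorem lcoeff_of_harmonicLog_eq_zero (h : p ∈ OrderSpace α) {b : G}
    (hb : harmonicLog b α = 0) : lcoeff α b p = 0 :=
  (isExpansion_coords h).1 b hb

theorem apply_eq_lcoeff_mul (h : p ∈ OrderSpace α) (m : G × LogExponent) :
    p m = lcoeff α m.1 p * harmonicLog m.1 α m :=
  (isExpansion_coords h).2 m

variable [IsStrictOrderedRing G]

/-- The pairing `⟨f(D) λ⟩ = ∑ b, f_b c_b ⌊b⌉!` of an Artinian operator with a series of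
coordinates `c`. -/
def pairing (f : HahnSeries G ℂ) (c : HahnSeries Gᵒᵈ ℂ) : ℂ :=
  ∑ᶠ b : G, f.coeff b * (c.coeff (toDual b) * rho b)

/-- The augmentation of `f(D) p` is a duality pairing. -/
theorem augmentation_applyOp (f : HahnSeries G ℂ) (p : LogSeries G) :
    augmentation α (applyOp f α p) = pairing f (coords α p) := by
  classical
  let E : G → ℂ := fun d => ∑ᶠ b : G, f.coeff b * lcoeff α (d + b) p *
    ((romanFactorial (algebraMap G ℝ (d + b)) / romanFactorial (algebraMap G ℝ d) : ℝ) : ℂ)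
  have hpwo : (Function.support fun x : Gᵒᵈ =>
      if harmonicLog (ofDual x) α = 0 then 0 else E (ofDual x)).IsPWO := by
    have h1 : ((fun b : G => toDual (-b)) '' f.support).IsPWO :=
      f.isPWO_support.image_of_monotone fun a b hab => toDual_le_toDual.2 (neg_le_neg hab)
    refine ((coords α p).isPWO_support.add h1).mono fun x hx => ?_
    rw [Function.mem_support] at hx
    split_ifs at hx with h0
    · exact absurd rfl hx
    obtain ⟨b, hb⟩ := not_forall.1 (mt finsum_eq_zero_of_forall_eq_zero hx)
    have hb' := left_ne_zero_of_mul hb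
    refine Set.mem_add.2 ⟨toDual (ofDual x + b), right_ne_zero_of_mul hb', toDual (-b),
      ⟨b, left_ne_zero_of_mul hb', rfl⟩, ?_⟩
    rw [← toDual_add, add_neg_cancel_right, toDual_ofDual]
  have hexp : IsExpansion α ⟨_, hpwo⟩ (applyOp f α p) := by
    refine ⟨fun b hb => by simp [hb], fun m => ?_⟩
    by_cases hm : harmonicLog m.1 α = 0
    · simp [applyOp, hm]
    · simp [applyOp, hm, E]
  rw [augmentation, hexp.lcoeff_eq]
  change (if harmonicLog (0 : G) α = 0 then 0 else E 0) = _
  rw [if_neg (harmonicLog_zero_ne_zero α)]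
  refine finsum_congr fun b => ?_
  rw [zero_add, map_zero, romanFactorial_zero, div_one, mul_assoc]
  rfl

end Series

/-! ### Summable families of rows -/

section Rows

variable {G : Type} [LinearOrder G]

/-- `M` is summable against every Noetherian family of coefficients; this is the condition that
`λ_a ↦ ∑ x, (M a)_x λ_x` extends to Noetherian sums. -/
def RowSummable (M : G → HahnSeries Gᵒᵈ ℂ) : Prop :=
  ∀ c : HahnSeries Gᵒᵈ ℂ, ∃ s : HahnSeries.SummableFamily Gᵒᵈ ℂ G,
    ∀ a, s a = c.coeff (toDual a) • M a

/-- Summability of rows depends only on their supports. -/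
theorem rowSummable_iff {M : G → HahnSeries Gᵒᵈ ℂ} :
    RowSummable M ↔ ∀ C : Set Gᵒᵈ, C.IsPWO →
      {x | ∃ a, toDual a ∈ C ∧ (M a).coeff x ≠ 0}.IsPWO ∧
        ∀ x, {a | toDual a ∈ C ∧ (M a).coeff x ≠ 0}.Finite := by
  classical
  constructor
  · intro h C hC
    let c : HahnSeries Gᵒᵈ ℂ :=
      ⟨fun x => if x ∈ C then 1 else 0, hC.mono fun x hx => by simpa using hx⟩
    obtain ⟨s, hs⟩ := h c
    have key : ∀ a x, toDual a ∈ C → (M a).coeff x ≠ 0 → (s a).coeff x ≠ 0 := by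
      intro a x ha hx
      rw [hs a]
      simpa [c, ha] using hx
    refine ⟨s.isPWO_iUnion_support.mono ?_, fun x => (s.finite_co_support' x).subset ?_⟩
    · rintro x ⟨a, ha, hx⟩
      exact Set.mem_iUnion.2 ⟨a, key a x ha hx⟩
    · rintro a ⟨ha, hx⟩
      exact key a x ha hx
  · intro h c
    obtain ⟨h1, h2⟩ := h c.support c.isPWO_support
    refine ⟨⟨fun a => c.coeff (toDual a) • M a, h1.mono ?_, fun x => (h2 x).subset ?_⟩,
      fun a => rfl⟩
    · intro x hx
      obtain ⟨a, ha⟩ := Set.mem_iUnion.1 hx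
      have ha' : c.coeff (toDual a) * (M a).coeff x ≠ 0 := by simpa using ha
      exact ⟨a, left_ne_zero_of_mul ha', right_ne_zero_of_mul ha'⟩
    · intro a ha
      have ha' : c.coeff (toDual a) * (M a).coeff x ≠ 0 := by simpa using ha
      exact ⟨left_ne_zero_of_mul ha', right_ne_zero_of_mul ha'⟩

variable {M N : G → HahnSeries Gᵒᵈ ℂ}

/-- The Noetherian sum `∑ a, c_a M_a`. -/
def RowSummable.combine (hM : RowSummable M) (c : HahnSeries Gᵒᵈ ℂ) : HahnSeries Gᵒᵈ ℂ :=
  (hM c).choose.hsum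

theorem RowSummable.coeff_combine (hM : RowSummable M) (c : HahnSeries Gᵒᵈ ℂ) (x : Gᵒᵈ) :
    (hM.combine c).coeff x = ∑ᶠ a : G, c.coeff (toDual a) * (M a).coeff x := by
  rw [RowSummable.combine, HahnSeries.SummableFamily.coeff_hsum]
  refine finsum_congr fun a => ?_
  rw [(hM c).choose_spec a, HahnSeries.coeff_smul, smul_eq_mul]

theorem RowSummable.finite_support (hM : RowSummable M) (c : HahnSeries Gᵒᵈ ℂ) (x : Gᵒᵈ) :
    {a : G | c.coeff (toDual a) * (M a).coeff x ≠ 0}.Finite :=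
  ((rowSummable_iff.1 hM c.support c.isPWO_support).2 x).subset fun _ ha =>
    ⟨left_ne_zero_of_mul ha, right_ne_zero_of_mul ha⟩

theorem RowSummable.exists_of_coeff_combine_ne_zero (hM : RowSummable M)
    {c : HahnSeries Gᵒᵈ ℂ} {x : Gᵒᵈ} (h : (hM.combine c).coeff x ≠ 0) :
    ∃ a : G, c.coeff (toDual a) ≠ 0 ∧ (M a).coeff x ≠ 0 := by
  rw [hM.coeff_combine] at h
  obtain ⟨a, ha⟩ := not_forall.1 (mt finsum_eq_zero_of_forall_eq_zero h)
  exact ⟨a, left_ne_zero_of_mul ha, right_ne_zero_of_mul ha⟩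

/-- The composite of two such linear maps extends to Noetherian sums: the rows `N a` that occur
have their supports in one Noetherian set, over which the rows of `M` are summable. -/
theorem RowSummable.comp (hM : RowSummable M) (hN : RowSummable N) :
    RowSummable fun a => hM.combine (N a) := by
  rw [rowSummable_iff]
  intro C hC
  obtain ⟨h1, h2⟩ := rowSummable_iff.1 hN C hC
  obtain ⟨h3, h4⟩ := rowSummable_iff.1 hM _ h1
  refine ⟨h3.mono ?_, fun x => ?_⟩
  · rintro x ⟨a, ha, hx⟩
    obtain ⟨e, he, hx'⟩ := hM.exists_of_coeff_combine_ne_zero hx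
    exact ⟨e, ⟨a, ha, he⟩, hx'⟩
  · refine ((h4 x).biUnion fun e _ => h2 (toDual e)).subset ?_
    rintro a ⟨ha, hx⟩
    obtain ⟨e, he, hx'⟩ := hM.exists_of_coeff_combine_ne_zero hx
    exact Set.mem_biUnion (show e ∈ _ from ⟨⟨a, ha, he⟩, hx'⟩) ⟨ha, he⟩

theorem finite_setOf_coeff_ne_zero (f : HahnSeries G ℂ) (c : HahnSeries Gᵒᵈ ℂ) :
    {b : G | f.coeff b ≠ 0 ∧ c.coeff (toDual b) ≠ 0}.Finite :=
  finite_setOf_mem_and_toDual_mem f.isPWO_support c.isPWO_support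

/-! ### The adjoint of a graded sequence -/

variable [CommRing G] [Algebra G ℝ]

/-- The adjoint `f ↦ ∑ a, (⟨f(D) p_a⟩ / ⌊a⌉!) D^a` of the linear map `λ_a ↦ p_a`, where
`M a` are the coordinates of `p_a`. Its value is an Artinian series: along an infinite strictly
decreasing sequence of exponents `a` in its support, `∑ p_a` would be a Noetherian sum whose
pairing with `f` involves finitely many monomials, each of which occurs in finitely many `p_a`. -/
def RowSummable.adjoint (hM : RowSummable M) (f : HahnSeries G ℂ) : HahnSeries G ℂ where
  coeff a := (rho a)⁻¹ * pairing f (M a)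
  isPWO_support' := by
    rw [Set.isPWO_iff_isWF, Set.isWF_iff_no_descending_seq]
    intro u hu hsupp
    have hC : (Set.range fun n => toDual (u n)).IsPWO := by
      rw [← Set.image_univ]
      exact (Set.isPWO_of_wellQuasiOrderedLE Set.univ).image_of_monotone
        fun m n hmn => toDual_le_toDual.2 (hu.antitone hmn)
    obtain ⟨h1, h2⟩ := rowSummable_iff.1 hM _ hC
    have hD := finite_setOf_mem_and_toDual_mem f.isPWO_support h1
    have hfin := hD.biUnion fun d _ => h2 (toDual d)
    refine Set.infinite_of_injective_forall_mem hu.injective (fun n => ?_) hfin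
    have hn : pairing f (M (u n)) ≠ 0 := right_ne_zero_of_mul (hsupp n)
    obtain ⟨d, hd⟩ := not_forall.1 (mt finsum_eq_zero_of_forall_eq_zero hn)
    have hd1 := left_ne_zero_of_mul hd
    have hd2 := left_ne_zero_of_mul (right_ne_zero_of_mul hd)
    exact Set.mem_biUnion (show d ∈ _ from ⟨hd1, u n, ⟨n, rfl⟩, hd2⟩) ⟨⟨n, rfl⟩, hd2⟩

theorem RowSummable.coeff_adjoint (hM : RowSummable M) (f : HahnSeries G ℂ) (a : G) :
    (hM.adjoint f).coeff a = (rho a)⁻¹ * pairing f (M a) := rfl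

theorem RowSummable.pairing_eq (hM : RowSummable M) (f : HahnSeries G ℂ) (a : G) :
    pairing f (M a) = rho a * (hM.adjoint f).coeff a := by
  rw [hM.coeff_adjoint, mul_inv_cancel_left₀ (rho_ne_zero a)]

theorem RowSummable.pairing_combine (hM : RowSummable M) (f : HahnSeries G ℂ)
    (c : HahnSeries Gᵒᵈ ℂ) : pairing f (hM.combine c) = pairing (hM.adjoint f) c := by
  have h1 : pairing f (hM.combine c) = ∑ᶠ b : G, ∑ᶠ a : G,
      f.coeff b * (c.coeff (toDual a) * (M a).coeff (toDual b) * rho b) := by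
    refine finsum_congr fun b => ?_
    rw [hM.coeff_combine, finsum_mul, mul_finsum]
  have h2 : pairing (hM.adjoint f) c = ∑ᶠ a : G, ∑ᶠ b : G,
      f.coeff b * (c.coeff (toDual a) * (M a).coeff (toDual b) * rho b) := by
    refine finsum_congr fun a => ?_
    have h : (hM.adjoint f).coeff a * (c.coeff (toDual a) * rho a) =
        pairing f (M a) * c.coeff (toDual a) := by
      rw [hM.pairing_eq]
      ring
    rw [h, pairing, finsum_mul]
    refine finsum_congr fun b => ?_
    ring
  rw [h1, h2]
  refine finsum_comm_of_finite _ ?_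
  have hD := finite_setOf_mem_and_toDual_mem f.isPWO_support
    (rowSummable_iff.1 hM c.support c.isPWO_support).1
  refine (hD.biUnion (t := fun b => (fun a => (b, a)) ''
    {a | c.coeff (toDual a) * (M a).coeff (toDual b) ≠ 0})
    fun b _ => (hM.finite_support c (toDual b)).image _).subset ?_
  rintro ⟨b, a⟩ hba
  have hf := left_ne_zero_of_mul hba
  have hc := left_ne_zero_of_mul (right_ne_zero_of_mul hba)
  exact Set.mem_biUnion
    (show b ∈ _ from ⟨hf, a, left_ne_zero_of_mul hc, right_ne_zero_of_mul hc⟩) ⟨a, hc, rfl⟩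

theorem RowSummable.adjoint_comp (hM : RowSummable M) (hN : RowSummable N)
    (f : HahnSeries G ℂ) :
    (hM.comp hN).adjoint f = hN.adjoint (hM.adjoint f) := by
  ext a
  rw [coeff_adjoint, coeff_adjoint, hM.pairing_combine]

variable [IsStrictOrderedRing G]

/-- If the rows are dual to the powers `P b`, the adjoint inverts the composition map
`k ↦ ∑ b, k_b P_b`. -/
theorem RowSummable.adjoint_powerFamily_comp (hM : RowSummable M) {P : G → HahnSeries G ℂ}
    {S : Set G} (hP : IsPowerFamily P S) (k : HahnSeries G ℂ)
    (hdual : ∀ b, k.coeff b ≠ 0 → ∀ a, pairing (P b) (M a) = if a = b then rho a else 0) :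
    hM.adjoint (hP.comp k) = k := by
  ext a
  have h1 : pairing (hP.comp k) (M a) = ∑ᶠ d : G, ∑ᶠ b : G,
      k.coeff b * (P b).coeff d * ((M a).coeff (toDual d) * rho d) := by
    refine finsum_congr fun d => ?_
    rw [hP.coeff_comp, finsum_mul]
  have h2 : ∑ᶠ b : G, ∑ᶠ d : G,
      k.coeff b * (P b).coeff d * ((M a).coeff (toDual d) * rho d) = k.coeff a * rho a := by
    rw [finsum_eq_single _ a]
    · simp only [mul_assoc]
      rw [← mul_finsum]
      by_cases ha : k.coeff a = 0
      · simp [ha]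
      · have := hdual a ha a
        rw [if_pos rfl] at this
        exact congrArg _ this
    · intro b hb
      simp only [mul_assoc]
      rw [← mul_finsum]
      by_cases hkb : k.coeff b = 0
      · simp [hkb]
      · have := hdual b hkb a
        rw [if_neg (Ne.symm hb)] at this
        exact mul_eq_zero_of_right _ this
  rw [coeff_adjoint, h1, finsum_comm_of_finite, h2, mul_comm, mul_assoc,
    mul_inv_cancel₀ (rho_ne_zero a), mul_one]
  have hD := finite_setOf_mem_and_toDual_mem (hP.family k).isPWO_iUnion_support
    (M a).isPWO_support
  refine (hD.biUnion (t := fun d => (fun b => (d, b)) '' {b | k.coeff b * (P b).coeff d ≠ 0})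
    fun d _ => (hP.finite_support k d).image _).subset ?_
  rintro ⟨d, b⟩ hdb
  have hc := left_ne_zero_of_mul hdb
  have hd : d ∈ ⋃ b : G, (hP.family k b).support := Set.mem_iUnion.2 ⟨b, by
    change (k.coeff b • P b).coeff d ≠ 0
    simpa using hc⟩
  exact Set.mem_biUnion
    (show d ∈ _ from ⟨hd, left_ne_zero_of_mul (right_ne_zero_of_mul hdb)⟩) ⟨b, hc, rfl⟩

end Rows

/-! ### Umbral composition of graded sequences -/

section Umbral

variable {G : Type} [CommRing G] [LinearOrder G] [Algebra G ℝ]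
variable {A : Set LogExponent} {p q : LogExponent → G → LogSeries G} {α : LogExponent}

theorem IsGraded.rowSummable (hp : IsGraded A p) (hα : α ∈ A) :
    RowSummable fun a => coords α (p α a) :=
  (hp α hα).2.2.2

theorem isExpansion_umbralComp (hp : IsGraded A p) (hα : α ∈ A) (a : G) :
    IsExpansion α ((hp.rowSummable hα).combine (coords α (q α a))) (umbralComp q p α a) := by
  refine ⟨fun b hb => ?_, fun m => ?_⟩
  · rw [RowSummable.coeff_combine]
    refine finsum_eq_zero_of_forall_eq_zero fun e => ?_
    exact mul_eq_zero_of_right _ (lcoeff_of_harmonicLog_eq_zero ((hp α hα).1 e) hb)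
  · rw [RowSummable.coeff_combine, finsum_mul]
    refine finsum_congr fun e => ?_
    rw [apply_eq_lcoeff_mul ((hp α hα).1 e), mul_assoc]
    rfl

theorem coords_umbralComp (hp : IsGraded A p) (hα : α ∈ A) (a : G) :
    coords α (umbralComp q p α a) =
      (hp.rowSummable hα).combine (coords α (q α a)) :=
  (isExpansion_umbralComp hp hα a).coords_eq

theorem lcoeff_umbralComp (hp : IsGraded A p) (hα : α ∈ A) (a b : G) :
    lcoeff α b (umbralComp q p α a) =
      ∑ᶠ e : G, lcoeff α e (q α a) * lcoeff α b (p α e) := by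
  rw [lcoeff, coords_umbralComp hp hα, RowSummable.coeff_combine]
  rfl

/-- Only the degrees between `b` and `a` contribute to the coefficient of `λ_b` in `q_a(p)`. By
`hA` the harmonic logarithms of these degrees do not vanish if `λ_b` does not. -/
theorem IsRegular.umbralComp (hp : IsGraded A p)
    (hA : ∀ α ∈ A, ∀ b e : G, b ≤ e → harmonicLog b α ≠ 0 → harmonicLog e α ≠ 0)
    (hp' : IsRegular A p) (hq' : IsRegular A q) : IsRegular A (umbralComp q p) := by
  intro α hα β hβ a b hb hb'
  rw [lcoeff_umbralComp hp hα, lcoeff_umbralComp hp hβ]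
  refine finsum_congr fun e => ?_
  rw [hp' α hα β hβ e b hb hb']
  rcases lt_or_ge e b with h | h
  · rw [(hp β hβ).2.1 e b h, mul_zero, mul_zero]
  · rw [hq' α hα β hβ a e (hA α hα b e h hb) (hA β hβ b e h hb')]

theorem IsGraded.umbralConverges (hp : IsGraded A p) : UmbralConverges A q p := by
  intro α hα a m
  refine ((hp.rowSummable hα).finite_support (coords α (q α a)) (toDual m.1)).subset ?_
  intro b hb
  refine mul_ne_zero (left_ne_zero_of_mul hb) fun h => right_ne_zero_of_mul hb ?_
  rw [apply_eq_lcoeff_mul ((hp α hα).1 b)]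
  exact mul_eq_zero_of_left h _

theorem IsGraded.umbralComp (hp : IsGraded A p) (hq : IsGraded A q) :
    IsGraded A (umbralComp q p) := by
  intro α hα
  refine ⟨fun a => ⟨_, isExpansion_umbralComp hp hα a⟩, fun a b hab => ?_, fun a ha => ?_, ?_⟩
  · rw [lcoeff_umbralComp hp hα]
    refine finsum_eq_zero_of_forall_eq_zero fun e => ?_
    rcases lt_or_ge a e with h | h
    · rw [(hq α hα).2.1 a e h, zero_mul]
    · rw [(hp α hα).2.1 e b (h.trans_lt hab), mul_zero]
  · rw [lcoeff_umbralComp hp hα, finsum_eq_single _ a]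
    · exact mul_ne_zero ((hq α hα).2.2.1 a ha) ((hp α hα).2.2.1 a ha)
    · intro e he
      rcases lt_or_gt_of_ne he with h | h
      · rw [(hp α hα).2.1 e a h, mul_zero]
      · rw [(hq α hα).2.1 a e h, zero_mul]
  · simp only [coords_umbralComp hp hα]
    exact (hp.rowSummable hα).comp (hq.rowSummable hα)

theorem IsGraded.adjoint_umbralComp (hp : IsGraded A p) (hq : IsGraded A q) (hα : α ∈ A)
    (f : HahnSeries G ℂ) :
    ((hp.umbralComp hq).rowSummable hα).adjoint f =
      (hq.rowSummable hα).adjoint ((hp.rowSummable hα).adjoint f) := by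
  rw [← RowSummable.adjoint_comp]
  ext a
  rw [RowSummable.coeff_adjoint, RowSummable.coeff_adjoint, coords_umbralComp hp hα]

/-- The adjoint is injective: the lowest coefficient of `f` survives. -/
theorem IsGraded.adjoint_injective (hp : IsGraded A p) (hα : α ∈ A) (hα0 : α ≠ 0) :
    Function.Injective (hp.rowSummable hα).adjoint := by
  intro f g hfg
  by_contra hne
  have hsub : f - g ≠ 0 := sub_ne_zero.2 hne
  have hpair : ∀ a, pairing f (coords α (p α a)) = pairing g (coords α (p α a)) := by
    intro a
    rw [(hp.rowSummable hα).pairing_eq f a, (hp.rowSummable hα).pairing_eq g a, hfg]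
  set b := (f - g).order with hb
  have h0 : pairing (f - g) (coords α (p α b)) = 0 := by
    have h1 : pairing (f - g) (coords α (p α b)) =
        pairing f (coords α (p α b)) - pairing g (coords α (p α b)) := by
      unfold pairing
      rw [← finsum_sub_distrib]
      · refine finsum_congr fun e => ?_
        rw [HahnSeries.coeff_sub]
        ring
      · exact (finite_setOf_coeff_ne_zero f _).subset fun e he =>
          ⟨left_ne_zero_of_mul he, left_ne_zero_of_mul (right_ne_zero_of_mul he)⟩
      · exact (finite_setOf_coeff_ne_zero g _).subset fun e he =>
          ⟨left_ne_zero_of_mul he, left_ne_zero_of_mul (right_ne_zero_of_mul he)⟩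
    rw [h1, hpair, sub_self]
  rw [pairing, finsum_eq_single _ b] at h0
  · exact mul_ne_zero (mt HahnSeries.coeff_order_eq_zero.1 hsub)
      (mul_ne_zero ((hp α hα).2.2.1 b (harmonicLog_ne_zero b hα0)) (rho_ne_zero b)) h0
  · intro e he
    rcases lt_or_gt_of_ne he with h | h
    · rw [HahnSeries.coeff_eq_zero_of_lt_order h, zero_mul]
    · have : (coords α (p α b)).coeff (toDual e) = 0 := (hp α hα).2.1 b e h
      rw [this, zero_mul, mul_zero]

variable [IsStrictOrderedRing G]

theorem IsGraded.augmentation_eq (hp : IsGraded A p) (hα : α ∈ A) (f : HahnSeries G ℂ) (a : G) :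
    augmentation α (applyOp f α (p α a)) =
      rho a * ((hp.rowSummable hα).adjoint f).coeff a := by
  rw [augmentation_applyOp, ← RowSummable.pairing_eq]

/-! ### Associated sequences -/

theorem IsAssociated.pairing_eq {P : G → HahnSeries G ℂ} (h : IsAssociated A P p) (hα : α ∈ A)
    {b : G} (hb : α = 0 → 0 ≤ b) (a : G) :
    pairing (P b) (coords α (p α a)) = if a = b then rho a else 0 := by
  rw [← augmentation_applyOp, h.2 α hα a b hb]
  by_cases hab : a = b
  · rw [if_pos hab, if_pos hab]; rfl
  · rw [if_neg hab, if_neg hab]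

/-- Umbral composition of associated sequences corresponds to composition of the delta
operators, in the opposite order. -/
theorem IsAssociated.umbralComp {P Q : G → HahnSeries G ℂ} {S T : Set G}
    (hP : IsPowerFamily P S) (hQ : IsPowerFamily Q T)
    (hp : IsAssociated A P p) (hq : IsAssociated A Q q) :
    IsAssociated A (fun b => hP.comp (Q b)) (umbralComp q p) := by
  refine ⟨hp.1.umbralComp hq.1, fun α hα a b hb => ?_⟩
  have h1 : (hp.1.rowSummable hα).adjoint (hP.comp (Q b)) = Q b := by
    refine RowSummable.adjoint_powerFamily_comp _ hP _ fun e he a' => ?_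
    exact hp.pairing_eq hα (fun h => (hb h).trans (hQ.le_of_coeff_ne_zero he)) a'
  rw [(hp.1.umbralComp hq.1).augmentation_eq hα, hp.1.adjoint_umbralComp hq.1 hα, h1,
    ← RowSummable.pairing_eq, hq.pairing_eq hα hb]
  by_cases hab : a = b
  · rw [if_pos hab, if_pos hab]; rfl
  · rw [if_neg hab, if_neg hab]

/-- The delta operator is determined by its associated sequence, through the first power. -/
theorem IsAssociated.powers_unique {P Q : G → HahnSeries G ℂ} (hα : α ∈ A) (hα0 : α ≠ 0)
    (hP : IsAssociated A P p) (hQ : IsAssociated A Q p) : P = Q := by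
  funext b
  refine hP.1.adjoint_injective hα hα0 ?_
  ext a
  rw [RowSummable.coeff_adjoint, RowSummable.coeff_adjoint,
    hP.pairing_eq hα (fun h => absurd h hα0), hQ.pairing_eq hα (fun h => absurd h hα0)]

/-! ### Roman graded sequences -/

/-- The binomial identity says that the adjoint is multiplicative. -/
theorem IsGraded.binomial_iff (hp : IsGraded A p) (hα : α ∈ A) :
    (∀ (a : G) (f g : HahnSeries G ℂ),
      {b : G | augmentation α (applyOp f α (p α b)) *
        augmentation α (applyOp g α (p α (a - b))) ≠ 0}.Finite ∧
      augmentation α (applyOp (f * g) α (p α a)) =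
        ∑ᶠ b : G, (romanCoeff (algebraMap G ℝ a) (algebraMap G ℝ b) : ℂ) *
          (augmentation α (applyOp f α (p α b)) *
            augmentation α (applyOp g α (p α (a - b))))) ↔
    ∀ f g : HahnSeries G ℂ, (hp.rowSummable hα).adjoint (f * g) =
      (hp.rowSummable hα).adjoint f * (hp.rowSummable hα).adjoint g := by
  simp only [hp.augmentation_eq hα, rho_mul_eq]
  constructor
  · intro h f g
    ext a
    rw [coeff_mul_eq_finsum]
    refine mul_left_cancel₀ (rho_ne_zero a) ?_
    rw [(h a f g).2, mul_finsum]
  · intro h a f g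
    refine ⟨(finite_mul_support ((hp.rowSummable hα).adjoint f)
      ((hp.rowSummable hα).adjoint g) a).subset fun b hb => ?_, ?_⟩
    · exact mul_ne_zero (right_ne_zero_of_mul (left_ne_zero_of_mul hb))
        (right_ne_zero_of_mul (right_ne_zero_of_mul hb))
    · rw [h, coeff_mul_eq_finsum, mul_finsum]

theorem IsRoman.umbralComp
    (hA : ∀ α ∈ A, ∀ b e : G, b ≤ e → harmonicLog b α ≠ 0 → harmonicLog e α ≠ 0)
    (hp : IsRoman A p) (hq : IsRoman A q) : IsRoman A (umbralComp q p) := by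
  have hg := hp.1.umbralComp hq.1
  refine ⟨hg, IsRegular.umbralComp hp.1 hA hp.2.1 hq.2.1, fun α hα hα0 => ?_⟩
  rw [hg.binomial_iff hα]
  intro f g
  rw [hp.1.adjoint_umbralComp hq.1 hα, hp.1.adjoint_umbralComp hq.1 hα,
    hp.1.adjoint_umbralComp hq.1 hα, (hp.1.binomial_iff hα).1 (hp.2.2 α hα hα0),
    (hq.1.binomial_iff hα).1 (hq.2.2 α hα hα0)]

end Umbral

/-! ### Binomial powers of Hahn series -/

section Binomial

variable {G : Type*} [AddCommGroup G] [LinearOrder G] [IsOrderedAddMonoid G]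

/-- The power `(1 + x) ^ a` of a Hahn series, for `x` of positive order. -/
abbrev onePlusPow (x : HahnSeries G ℂ) (a : ℂ) : HahnSeries G ℂ :=
  PowerSeries.heval x (PowerSeries.binomialSeries ℂ a)

theorem onePlusPow_natCast {x : HahnSeries G ℂ} (hx : 0 < x.orderTop) (n : ℕ) :
    onePlusPow x n = (1 + x) ^ n := by
  rw [onePlusPow, PowerSeries.binomialSeries_nat, map_pow, map_add, map_one,
    PowerSeries.heval_X x hx]

theorem onePlusPow_one {x : HahnSeries G ℂ} (hx : 0 < x.orderTop) :
    onePlusPow x 1 = 1 + x := by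
  simpa using onePlusPow_natCast hx 1

theorem exists_polynomial_choose (n : ℕ) :
    ∃ Q : Polynomial ℂ, ∀ a : ℂ, Ring.choose a n = Q.eval a := by
  refine ⟨Polynomial.C ((n.factorial : ℂ)⁻¹) * (descPochhammer ℤ n).map (Int.castRingHom ℂ),
    fun a => ?_⟩
  rw [Ring.choose_eq_smul, Polynomial.eval_mul, Polynomial.eval_C, Polynomial.eval_map,
    smul_eq_mul, ← Polynomial.aeval_eq_smeval]
  rfl

/-- The exponents that occur in the powers of `x`. -/
def powersSupport (x : HahnSeries G ℂ) : Set G := ⋃ n : ℕ, (x ^ n).support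

theorem isPWO_powersSupport {x : HahnSeries G ℂ} (hx : 0 < x.orderTop) :
    (powersSupport x).IsPWO :=
  HahnSeries.SummableFamily.isPWO_iUnion_support_powers (HahnSeries.zero_le_orderTop_iff.1 hx.le)

theorem nonneg_of_mem_powersSupport {x : HahnSeries G ℂ} (hx : 0 < x.orderTop) {d : G}
    (hd : d ∈ powersSupport x) : 0 ≤ d := by
  obtain ⟨n, hn⟩ := Set.mem_iUnion.1 hd
  have h1 : (0 : WithTop G) ≤ n • x.orderTop := nsmul_nonneg hx.le n
  have h2 := (h1.trans HahnSeries.orderTop_nsmul_le_orderTop_pow).trans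
    (HahnSeries.orderTop_le_of_coeff_ne_zero hn)
  exact_mod_cast h2

theorem mem_powersSupport_of_coeff_ne_zero {x : HahnSeries G ℂ} (hx : 0 < x.orderTop) {a : ℂ}
    {d : G} (h : (onePlusPow x a).coeff d ≠ 0) : d ∈ powersSupport x := by
  rw [coeff_heval_eq_finsum hx] at h
  obtain ⟨n, hn⟩ := not_forall.1 (mt finsum_eq_zero_of_forall_eq_zero h)
  exact Set.mem_iUnion.2 ⟨n, right_ne_zero_of_mul hn⟩

/-- The coefficients of `(1 + x) ^ a` are polynomials in `a`. -/
theorem exists_polynomial_coeff_onePlusPow {x : HahnSeries G ℂ} (hx : 0 < x.orderTop) (d : G) :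
    ∃ Q : Polynomial ℂ, ∀ a : ℂ, (onePlusPow x a).coeff d = Q.eval a := by
  choose R hR using exists_polynomial_choose
  have hfin : {n : ℕ | (x ^ n).coeff d ≠ 0}.Finite :=
    HahnSeries.SummableFamily.pow_finite_co_support hx d
  refine ⟨∑ n ∈ hfin.toFinset, R n * Polynomial.C ((x ^ n).coeff d), fun a => ?_⟩
  rw [coeff_heval_eq_finsum hx, finsum_eq_sum_of_support_subset (s := hfin.toFinset)]
  · simp [Polynomial.eval_finsetSum, hR]
  · intro n hn
    rw [Set.Finite.coe_toFinset]
    exact right_ne_zero_of_mul hn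

theorem orderTop_pos_of_one_add_mul {x y z : HahnSeries G ℂ} (hx : 0 < x.orderTop)
    (hy : 0 < y.orderTop) (hz : 1 + z = (1 + x) * (1 + y)) : 0 < z.orderTop := by
  have hz' : z = x + y + x * y := by linear_combination hz
  refine orderTop_pos_of_forall_le fun d hd => ?_
  have hxy : (x * y).coeff d = 0 := by
    rw [coeff_mul_eq_finsum]
    refine finsum_eq_zero_of_forall_eq_zero fun b => ?_
    rcases le_or_gt b 0 with hb | hb
    · rw [coeff_eq_zero_of_orderTop_pos hx hb, zero_mul]
    · rw [coeff_eq_zero_of_orderTop_pos hy (sub_nonpos.2 (hd.trans hb.le)), mul_zero]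
  rw [hz', HahnSeries.coeff_add, HahnSeries.coeff_add, hxy, coeff_eq_zero_of_orderTop_pos hx hd,
    coeff_eq_zero_of_orderTop_pos hy hd, add_zero, add_zero]

/-- `(1 + x) ^ a * (1 + y) ^ a = ((1 + x) * (1 + y)) ^ a`: both sides have coefficients
polynomial in `a`, and they agree for natural numbers `a`. -/
theorem onePlusPow_mul {x y z : HahnSeries G ℂ} (hx : 0 < x.orderTop)
    (hy : 0 < y.orderTop) (hz : 1 + z = (1 + x) * (1 + y)) (a : ℂ) :
    onePlusPow x a * onePlusPow y a = onePlusPow z a := by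
  have hz0 := orderTop_pos_of_one_add_mul hx hy hz
  ext d
  choose U hU using fun b => exists_polynomial_coeff_onePlusPow hx b
  choose V hV using fun b => exists_polynomial_coeff_onePlusPow hy b
  obtain ⟨W, hW⟩ := exists_polynomial_coeff_onePlusPow hz0 d
  have hfin := finite_setOf_mem_and_sub_mem (isPWO_powersSupport hx) (isPWO_powersSupport hy) d
  have hprod : ∀ a : ℂ, (onePlusPow x a * onePlusPow y a).coeff d =
      (∑ b ∈ hfin.toFinset, U b * V (d - b)).eval a := by
    intro a
    rw [coeff_mul_eq_finsum, finsum_eq_sum_of_support_subset (s := hfin.toFinset)]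
    · simp [Polynomial.eval_finsetSum, ← hU, ← hV]
    · intro b hb
      rw [Set.Finite.coe_toFinset]
      exact ⟨mem_powersSupport_of_coeff_ne_zero hx (left_ne_zero_of_mul hb),
        mem_powersSupport_of_coeff_ne_zero hy (right_ne_zero_of_mul hb)⟩
  have hpoly : (∑ b ∈ hfin.toFinset, U b * V (d - b)) = W := by
    refine Polynomial.eq_of_infinite_eval_eq _ _ ?_
    refine (Set.infinite_range_of_injective (Nat.cast_injective (R := ℂ))).mono ?_
    rintro _ ⟨n, rfl⟩
    change Polynomial.eval _ _ = Polynomial.eval _ _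
    rw [← hprod, ← hW, onePlusPow_natCast hx, onePlusPow_natCast hy, onePlusPow_natCast hz0,
      hz, mul_pow]
  rw [hprod, hW, hpoly]

end Binomial

/-! ### Powers of delta operators -/

theorem IsPowerFamily.isDelta_comp {G : Type} [CommRing G] [LinearOrder G]
    [IsStrictOrderedRing G] {P : G → HahnSeries G ℂ} {S : Set G}
    (hP : IsPowerFamily P S) (hP1 : IsDelta (P 1)) {g : HahnSeries G ℂ} (hg : IsDelta g) :
    IsDelta (hP.comp g) := by
  refine ⟨?_, fun b hb => ?_⟩
  · rw [hP.coeff_comp_of_forall_lt hg.2]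
    exact mul_ne_zero hg.1 hP1.1
  · by_contra h
    obtain ⟨e, he, hge⟩ := hP.exists_le_of_coeff_comp_ne_zero h
    exact hge (hg.2 e (he.trans_lt hb))

section Delta

variable {G : Type} [CommRing G] [LinearOrder G] {f : HahnSeries G ℂ}

theorem IsDelta.ne_zero (hf : IsDelta f) : f ≠ 0 := HahnSeries.ne_zero_of_coeff_ne_zero hf.1

theorem IsDelta.order_eq (hf : IsDelta f) : f.order = 1 := by
  refine le_antisymm (HahnSeries.order_le_of_coeff_ne_zero hf.1) ?_
  exact (HahnSeries.le_order_iff_forall hf.ne_zero).2 hf.2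

theorem IsDelta.leadingCoeff_eq (hf : IsDelta f) : f.leadingCoeff = f.coeff 1 := by
  rw [HahnSeries.leadingCoeff_eq, hf.order_eq]

variable [IsStrictOrderedRing G]

/-- The tail `h` in `f = c D (1 + h)`. -/
def deltaTail (f : HahnSeries G ℂ) : HahnSeries G ℂ :=
  HahnSeries.single (-1) (f.coeff 1)⁻¹ * f - 1

theorem IsDelta.orderTop_deltaTail_pos (hf : IsDelta f) : 0 < (deltaTail f).orderTop := by
  refine orderTop_pos_of_forall_le fun d hd => ?_
  rw [deltaTail, HahnSeries.coeff_sub, HahnSeries.coeff_single_mul, sub_neg_eq_add,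
    HahnSeries.coeff_one]
  rcases hd.eq_or_lt with rfl | hd
  · rw [zero_add, inv_mul_cancel₀ hf.1, if_pos rfl, sub_self]
  · have hd1 : d + 1 < 1 := by simpa using hd
    rw [hf.2 _ hd1, if_neg hd.ne, mul_zero, sub_zero]

theorem IsDelta.eq_mul_deltaTail (hf : IsDelta f) :
    f = HahnSeries.single 1 (f.coeff 1) * (1 + deltaTail f) := by
  rw [deltaTail, add_sub_cancel, ← mul_assoc, HahnSeries.single_mul_single, add_neg_cancel,
    mul_inv_cancel₀ hf.1, HahnSeries.single_zero_one, one_mul]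

theorem one_add_deltaTail_of_eq {c : ℂ} {u : HahnSeries G ℂ} (hc : c ≠ 0)
    (hf : f = HahnSeries.single 1 c * u) (hcf : f.coeff 1 = c) : 1 + deltaTail f = u := by
  rw [deltaTail, add_sub_cancel, hcf, hf, ← mul_assoc, HahnSeries.single_mul_single,
    neg_add_cancel, inv_mul_cancel₀ hc, HahnSeries.single_zero_one, one_mul]

end Delta

section Discrete

variable {f : HahnSeries ℤ ℂ}

theorem IsDelta.order_zpow (hf : IsDelta f) (b : ℤ) : (f ^ b).order = b := by
  have hnat : ∀ n : ℕ, (f ^ (n : ℤ)).order = n := fun n => by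
    rw [zpow_natCast, HahnSeries.order_pow, hf.order_eq]
    simp
  rcases b.eq_nat_or_neg with ⟨n, rfl | rfl⟩
  · exact hnat n
  · have h1 : f ^ (n : ℤ) ≠ 0 := zpow_ne_zero _ hf.ne_zero
    have h2 : f ^ (-(n : ℤ)) ≠ 0 := zpow_ne_zero _ hf.ne_zero
    have h3 := HahnSeries.order_mul h1 h2
    rw [zpow_neg, mul_inv_cancel₀ h1, HahnSeries.order_one, ← zpow_neg, hnat] at h3
    omega

theorem IsDelta.isPowerFamily_zpow (hf : IsDelta f) :
    IsPowerFamily (fun b : ℤ => f ^ b) (Set.Ici 0) where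
  isPWO := bddBelow_Ici.isWF.isPWO
  nonneg _ hs := hs
  map_zero := zpow_zero f
  map_add a b := zpow_add₀ hf.ne_zero a b
  support b d h := by
    have := HahnSeries.order_le_of_coeff_ne_zero h
    rw [hf.order_zpow] at this
    exact sub_nonneg.2 this

end Discrete

section Continuous

variable {f g : HahnSeries ℝ ℂ}

theorem IsDelta.branchPow_eq (hf : IsDelta f) (n : ℤ) (a : ℝ) :
    branchPow n f a = HahnSeries.single a
      (Complex.exp (a * (Complex.log (f.coeff 1) + 2 * Real.pi * Complex.I * n))) *
        onePlusPow (deltaTail f) a := by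
  rw [branchPow, hf.order_eq, hf.leadingCoeff_eq, mul_one]
  rfl

theorem IsDelta.branchPow_one (hf : IsDelta f) (n : ℤ) : branchPow n f 1 = f := by
  have h1 : Complex.exp (((1 : ℝ) : ℂ) *
      (Complex.log (f.coeff 1) + 2 * Real.pi * Complex.I * n)) = f.coeff 1 := by
    rw [Complex.ofReal_one, one_mul, Complex.exp_add, Complex.exp_log hf.1,
      mul_comm (2 * (Real.pi : ℂ) * Complex.I) (n : ℂ), Complex.exp_int_mul_two_pi_mul_I, mul_one]
  rw [hf.branchPow_eq, h1, Complex.ofReal_one, onePlusPow_one hf.orderTop_deltaTail_pos,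
    ← hf.eq_mul_deltaTail]

theorem IsDelta.isPowerFamily_branchPow (hf : IsDelta f) (n : ℤ) :
    IsPowerFamily (branchPow n f) (powersSupport (deltaTail f)) where
  isPWO := isPWO_powersSupport hf.orderTop_deltaTail_pos
  nonneg _ hs := nonneg_of_mem_powersSupport hf.orderTop_deltaTail_pos hs
  map_zero := by
    rw [hf.branchPow_eq, onePlusPow, Complex.ofReal_zero, PowerSeries.binomialSeries_zero,
      map_one, zero_mul, Complex.exp_zero, HahnSeries.single_zero_one, mul_one]
  map_add a b := by
    rw [hf.branchPow_eq, hf.branchPow_eq, hf.branchPow_eq, mul_mul_mul_comm,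
      HahnSeries.single_mul_single, ← Complex.exp_add, onePlusPow, onePlusPow, onePlusPow,
      ← map_mul, ← PowerSeries.binomialSeries_add, Complex.ofReal_add, add_mul]
  support b d h := by
    rw [hf.branchPow_eq, HahnSeries.coeff_single_mul] at h
    exact mem_powersSupport_of_coeff_ne_zero hf.orderTop_deltaTail_pos (right_ne_zero_of_mul h)

theorem IsDelta.isDelta_comp_branchPow (hf : IsDelta f) (hg : IsDelta g) (n : ℤ) :
    IsDelta ((hf.isPowerFamily_branchPow n).comp g) :=
  (hf.isPowerFamily_branchPow n).isDelta_comp (by rwa [hf.branchPow_one]) hg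

theorem IsDelta.coeff_one_comp_branchPow (hf : IsDelta f) (hg : IsDelta g) (n : ℤ) :
    ((hf.isPowerFamily_branchPow n).comp g).coeff 1 = g.coeff 1 * f.coeff 1 := by
  rw [IsPowerFamily.coeff_comp_of_forall_lt _ hg.2, hf.branchPow_one]

/-- Composition with `f` takes the powers of `g` to those of `g(f)`, on the branch `N` for which
the logarithms of the leading coefficients add up. -/
theorem IsDelta.comp_branchPow (hf : IsDelta f) (hg : IsDelta g) {n m N : ℤ}
    (hN : Complex.log (f.coeff 1) + 2 * Real.pi * Complex.I * n +
      (Complex.log (g.coeff 1) + 2 * Real.pi * Complex.I * m) =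
      Complex.log (g.coeff 1 * f.coeff 1) + 2 * Real.pi * Complex.I * N) (a : ℝ) :
    (hf.isPowerFamily_branchPow n).comp (branchPow m g a) =
      branchPow N ((hf.isPowerFamily_branchPow n).comp g) a := by
  set hP := hf.isPowerFamily_branchPow n
  have hh : IsDelta (hP.comp g) := hf.isDelta_comp_branchPow hg n
  have hc : (hP.comp g).coeff 1 = g.coeff 1 * f.coeff 1 := hf.coeff_one_comp_branchPow hg n
  have hone : hP.comp 1 = 1 := map_one hP.compHom
  have hy := hP.orderTop_comp_pos hg.orderTop_deltaTail_pos
  have htail : 1 + deltaTail (hP.comp g) =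
      (1 + deltaTail f) * (1 + hP.comp (deltaTail g)) := by
    refine one_add_deltaTail_of_eq (mul_ne_zero hg.1 hf.1) ?_ hc
    conv_lhs => rw [hg.eq_mul_deltaTail]
    rw [hP.comp_mul, hP.comp_add, hone, hP.comp_single, hf.branchPow_one,
      ← HahnSeries.single_zero_mul_eq_smul]
    calc _ = HahnSeries.single 0 (g.coeff 1) *
          (HahnSeries.single 1 (f.coeff 1) * (1 + deltaTail f)) * (1 + hP.comp (deltaTail g)) := by
          rw [← hf.eq_mul_deltaTail]
      _ = _ := by
          rw [← mul_assoc, HahnSeries.single_mul_single, zero_add, mul_assoc]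
  have hexp : ∀ u v : ℂ, Complex.exp (a * (u + v)) = Complex.exp (a * v) * Complex.exp (a * u) :=
    fun u v => by rw [mul_add, add_comm, Complex.exp_add]
  rw [hh.branchPow_eq, hg.branchPow_eq, hP.comp_mul, hP.comp_single, hP.comp_heval
    hg.orderTop_deltaTail_pos, hf.branchPow_eq, ← onePlusPow_mul hf.orderTop_deltaTail_pos hy
    htail, hc, ← hN, hexp (Complex.log (f.coeff 1) + _), ← HahnSeries.single_zero_mul_eq_smul,
    ← mul_assoc, HahnSeries.single_mul_single, zero_add, mul_assoc]

/-- The logarithms of the leading coefficients add up to a logarithm of their product, on some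
branch. -/
theorem exists_branch (hf : IsDelta f) (hg : IsDelta g) (n m : ℤ) :
    ∃ N : ℤ, Complex.log (f.coeff 1) + 2 * Real.pi * Complex.I * n +
      (Complex.log (g.coeff 1) + 2 * Real.pi * Complex.I * m) =
      Complex.log (g.coeff 1 * f.coeff 1) + 2 * Real.pi * Complex.I * N := by
  have h : Complex.exp (Complex.log (f.coeff 1) + Complex.log (g.coeff 1)) =
      Complex.exp (Complex.log (g.coeff 1 * f.coeff 1)) := by
    rw [Complex.exp_add, Complex.exp_log hf.1, Complex.exp_log hg.1,
      Complex.exp_log (mul_ne_zero hg.1 hf.1), mul_comm]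
  obtain ⟨k, hk⟩ := Complex.exp_eq_exp_iff_exists_int.1 h
  refine ⟨n + m + k, ?_⟩
  push_cast
  linear_combination hk

end Continuous

/-! ### Closure under umbral composition -/

theorem single_zero_one_ne_zero : (Finsupp.single 0 1 : LogExponent) ≠ 0 := by
  simp

/-- Umbral composition of branch-`n` and branch-`m` associated sequences, for any branch `N` on
which the logarithms of the leading coefficients add up. -/
theorem ContinuousAssociated.umbralComp {f g : HahnSeries ℝ ℂ}
    {p q : LogExponent → ℝ → LogSeries ℝ} {n m N : ℤ} (hf : IsDelta f) (hg : IsDelta g)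
    (hN : Complex.log (f.coeff 1) + 2 * Real.pi * Complex.I * n +
      (Complex.log (g.coeff 1) + 2 * Real.pi * Complex.I * m) =
      Complex.log (g.coeff 1 * f.coeff 1) + 2 * Real.pi * Complex.I * N)
    (hp : ContinuousAssociated n f p) (hq : ContinuousAssociated m g q) :
    ContinuousAssociated N ((hf.isPowerFamily_branchPow n).comp g) (umbralComp q p) := by
  have h := IsAssociated.umbralComp (hf.isPowerFamily_branchPow n) (hg.isPowerFamily_branchPow m)
    hp hq
  rwa [funext (hf.comp_branchPow hg hN)] at h

theorem log_add_log_of_arg {z w : ℂ} (hz : z ≠ 0) (hw : w ≠ 0)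
    (h : Complex.arg z + Complex.arg w ∈ Set.Ioc (-Real.pi) Real.pi) :
    Complex.log z + 2 * Real.pi * Complex.I * (0 : ℤ) +
      (Complex.log w + 2 * Real.pi * Complex.I * (0 : ℤ)) =
      Complex.log (w * z) + 2 * Real.pi * Complex.I * (0 : ℤ) := by
  rw [mul_comm w z, Complex.log_mul hz hw h]
  simp

theorem DiscreteAssociated.umbralComp {f g : HahnSeries ℤ ℂ}
    {p q : LogExponent → ℤ → LogSeries ℤ} (hf : IsDelta f) (hg : IsDelta g)
    (hp : DiscreteAssociated f p) (hq : DiscreteAssociated g q) :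
    DiscreteAssociated (hf.isPowerFamily_zpow.comp g) (umbralComp q p) := by
  have h := IsAssociated.umbralComp hf.isPowerFamily_zpow hg.isPowerFamily_zpow hp hq
  have hpow : (fun b : ℤ => hf.isPowerFamily_zpow.comp (g ^ b)) =
      fun b : ℤ => hf.isPowerFamily_zpow.comp g ^ b :=
    funext fun b => map_zpow₀ hf.isPowerFamily_zpow.compHom g b
  rwa [hpow] at h

end RomanUmbral

end

theorem mainTheorem2 :
    -- discrete case
    (∀ (f g : HahnSeries ℤ ℂ) (p q : RomanUmbral.LogExponent → ℤ → RomanUmbral.LogSeries ℤ),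
      RomanUmbral.IsDelta f → RomanUmbral.IsDelta g →
      RomanUmbral.DiscreteAssociated f p → RomanUmbral.DiscreteAssociated g q →
      RomanUmbral.UmbralConverges Set.univ q p ∧
      ∃ h : HahnSeries ℤ ℂ, RomanUmbral.IsComposition g (fun b : ℤ => f ^ b) h ∧
        RomanUmbral.IsDelta h ∧
        RomanUmbral.DiscreteAssociated h (RomanUmbral.umbralComp q p) ∧
        ∀ h' : HahnSeries ℤ ℂ, RomanUmbral.IsDelta h' →
          RomanUmbral.DiscreteAssociated h' (RomanUmbral.umbralComp q p) → h' = h) ∧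
    -- continuous case
    (∀ (f g : HahnSeries ℝ ℂ) (p q : RomanUmbral.LogExponent → ℝ → RomanUmbral.LogSeries ℝ),
      RomanUmbral.IsDelta f → RomanUmbral.IsDelta g →
      Complex.arg (f.coeff 1) + Complex.arg (g.coeff 1) ∈ Set.Ioc (-Real.pi) Real.pi →
      RomanUmbral.ContinuousAssociated 0 f p → RomanUmbral.ContinuousAssociated 0 g q →
      RomanUmbral.UmbralConverges RomanUmbral.nonzeroOrders q p ∧
      ∃ h : HahnSeries ℝ ℂ, RomanUmbral.IsComposition g (RomanUmbral.branchPow 0 f) h ∧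
        RomanUmbral.IsDelta h ∧
        RomanUmbral.ContinuousAssociated 0 h (RomanUmbral.umbralComp q p) ∧
        ∀ h' : HahnSeries ℝ ℂ, RomanUmbral.IsDelta h' →
          RomanUmbral.ContinuousAssociated 0 h' (RomanUmbral.umbralComp q p) → h' = h) ∧
    -- discrete Roman graded sequences are closed under umbral composition
    (∀ p q : RomanUmbral.LogExponent → ℤ → RomanUmbral.LogSeries ℤ,
      RomanUmbral.IsRoman Set.univ p → RomanUmbral.IsRoman Set.univ q →
      RomanUmbral.UmbralConverges Set.univ q p ∧
        RomanUmbral.IsRoman Set.univ (RomanUmbral.umbralComp q p)) ∧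
    -- continuous Roman graded sequences are closed under umbral composition
    (∀ p q : RomanUmbral.LogExponent → ℝ → RomanUmbral.LogSeries ℝ,
      RomanUmbral.IsRoman RomanUmbral.nonzeroOrders p →
      RomanUmbral.IsRoman RomanUmbral.nonzeroOrders q →
      RomanUmbral.UmbralConverges RomanUmbral.nonzeroOrders q p ∧
        RomanUmbral.IsRoman RomanUmbral.nonzeroOrders (RomanUmbral.umbralComp q p)) ∧
    -- so are the sequences that are an n-th associated sequence of some delta operator
    (∀ p q : RomanUmbral.LogExponent → ℝ → RomanUmbral.LogSeries ℝ,
      (∃ (n : ℤ) (f : HahnSeries ℝ ℂ),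
        RomanUmbral.IsDelta f ∧ RomanUmbral.ContinuousAssociated n f p) →
      (∃ (n : ℤ) (g : HahnSeries ℝ ℂ),
        RomanUmbral.IsDelta g ∧ RomanUmbral.ContinuousAssociated n g q) →
      RomanUmbral.UmbralConverges RomanUmbral.nonzeroOrders q p ∧
      ∃ (n : ℤ) (h : HahnSeries ℝ ℂ),
        RomanUmbral.IsDelta h ∧
          RomanUmbral.ContinuousAssociated n h (RomanUmbral.umbralComp q p)) ∧
    -- and the standard Roman graded sequences
    (∀ p q : RomanUmbral.LogExponent → ℝ → RomanUmbral.LogSeries ℝ,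
      RomanUmbral.IsStandardRoman p → RomanUmbral.IsStandardRoman q →
      RomanUmbral.UmbralConverges RomanUmbral.nonzeroOrders q p ∧
        RomanUmbral.IsStandardRoman (RomanUmbral.umbralComp q p)) := by
  refine ⟨?_, ?_, ?_, ?_, ?_, ?_⟩
  · intro f g p q hf hg hp hq
    refine ⟨hp.1.umbralConverges, hf.isPowerFamily_zpow.comp g,
      ⟨hf.isPowerFamily_zpow.family g, fun _ => rfl, rfl⟩,
      hf.isPowerFamily_zpow.isDelta_comp (by simpa using hf) hg,
      RomanUmbral.DiscreteAssociated.umbralComp hf hg hp hq, fun h' _ hh' => ?_⟩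
    have := RomanUmbral.IsAssociated.powers_unique (Set.mem_univ _)
      RomanUmbral.single_zero_one_ne_zero hh'
      (RomanUmbral.DiscreteAssociated.umbralComp hf hg hp hq)
    simpa using congrFun this 1
  · intro f g p q hf hg harg hp hq
    have hcomp := RomanUmbral.ContinuousAssociated.umbralComp hf hg
      (RomanUmbral.log_add_log_of_arg hf.1 hg.1 harg) hp hq
    have hdelta := hf.isDelta_comp_branchPow hg 0
    refine ⟨hp.1.umbralConverges, (hf.isPowerFamily_branchPow 0).comp g,
      ⟨(hf.isPowerFamily_branchPow 0).family g, fun _ => rfl, rfl⟩, hdelta, hcomp,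
      fun h' hd' hh' => ?_⟩
    have := RomanUmbral.IsAssociated.powers_unique
      (show _ ∈ RomanUmbral.nonzeroOrders from RomanUmbral.single_zero_one_ne_zero)
      RomanUmbral.single_zero_one_ne_zero hh' hcomp
    have h1 := congrFun this 1
    rwa [hd'.branchPow_one, hdelta.branchPow_one] at h1
  · intro p q hp hq
    exact ⟨hp.1.umbralConverges, RomanUmbral.IsRoman.umbralComp
      (fun α _ b e hbe hb => RomanUmbral.harmonicLog_ne_zero_of_le_int hbe hb) hp hq⟩
  · intro p q hp hq
    exact ⟨hp.1.umbralConverges, RomanUmbral.IsRoman.umbralComp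
      (fun α hα _ e _ _ => RomanUmbral.harmonicLog_ne_zero e hα) hp hq⟩
  · rintro p q ⟨n, f, hf, hp⟩ ⟨m, g, hg, hq⟩
    obtain ⟨N, hN⟩ := RomanUmbral.exists_branch hf hg n m
    exact ⟨hp.1.umbralConverges, N, _, hf.isDelta_comp_branchPow hg n,
      RomanUmbral.ContinuousAssociated.umbralComp hf hg hN hp hq⟩
  · rintro p q ⟨f, ⟨hf, c, hc, hfc⟩, hp⟩ ⟨g, ⟨hg, d, hd, hgd⟩, hq⟩
    -- positive leading coefficients have argument zero, so no branch is crossed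
    have harg : Complex.arg (f.coeff 1) + Complex.arg (g.coeff 1) ∈
        Set.Ioc (-Real.pi) Real.pi := by
      rw [hfc, hgd, Complex.arg_ofReal_of_nonneg hc.le, Complex.arg_ofReal_of_nonneg hd.le,
        add_zero]
      exact ⟨neg_lt_zero.2 Real.pi_pos, Real.pi_pos.le⟩
    refine ⟨hp.1.umbralConverges, (hf.isPowerFamily_branchPow 0).comp g,
      ⟨hf.isDelta_comp_branchPow hg 0, d * c, mul_pos hd hc, ?_⟩,
      RomanUmbral.ContinuousAssociated.umbralComp hf hg
        (RomanUmbral.log_add_log_of_arg hf.1 hg.1 harg) hp hq⟩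
    rw [hf.coeff_one_comp_branchPow hg, hfc, hgd, Complex.ofReal_mul]
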